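/- Consider a discounted two-player zero-sum turn-based stochastic game $\mathcal M=(\mathcal S,\mathcal A,P,r,\gamma)$: the state set $\mathcal S=\mathcal S_1\sqcup\mathcal S_2$ is countable, each state $s$ has a finite nonempty set $\mathcal A_s$ of actions, $r(s,a)\in[0,1]$, $\gamma\in[0,1)$, player 1 (controlling $\mathcal S_1$) maximizes and player 2 (controlling $\mathcal S_2$) minimizes the value $V^\pi(s)=\mathbb E[\sum_{i\ge0}\gamma^i r(s_i,\pi(s_i))\mid s_0=s]$ of a deterministic stationary strategy $\pi=(\pi_1,\pi_2)$. A strategy $\pi^*$ is an equilibrium if $V^{\pi_1,\pi_2^*}\le V^{\pi^*}\le V^{\pi_1^*,\pi_2}$ for all $\pi_1,\pi_2$; its value function is $v^*$. A strategy $(\pi_1,\pi_2)$ is $\epsilon$-optimal if $V^{\bar\pi_1,\pi_2}(s)-v^*(s)\le\epsilon$ and $V^{\pi_1,\bar\pi_2}(s)-v^*(s)\ge-\epsilon$ for all $s,\bar\pi_1,\bar\pi_2$. Let $\phi(s,a)\in\mathbb R^K$ be nonnegative features with $\|\phi(s,a)\|_1\le1$ such that $P(s'|s,a)=\sum_{k}\phi_k(s,a)\psi_k(s')$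 for some functions $\psi_1,\dots,\psi_K$ on $\mathcal S$, and let $(s_1,a_1),\dots,(s_K,a_K)$ be state-action pairs such that the matrix $\Phi$ with rows $\phi(s_k,a_k)^T$ is invertible with $\|\Phi^{-1}\|_\infty\le L$ (maximal absolute row sum), $L>0$. Let $\epsilon,\delta\in(0,1)$. For $w\in\mathbb R^K$ and a nonempty finite set $\theta\subset\mathbb R^K$ let $Q_w(s,a)=r(s,a)+\gamma\phi(s,a)^Tw$ and let $V_\theta(s)$ be $\max_{w\in\theta}\max_{a\in\mathcal A_s}Q_w(s,a)$ if $s$ is controlled by the maximizer and $\max_{w\in\theta}\min_{a\in\mathcal A_s}Q_w(s,a)$ otherwise; $\pi_\theta(s)$ is a solution $a$ of this optimization problem (ties broken arbitrarily). One-sided algorithm. With absolute constants $c_1,\dots,c_6>0$ put $R'=\lceil c_1\log\frac1{\epsilon(1-\gamma)}\rceil$, $R=\lceil c_2R'/(1-\gamma)\rceil$, $\ell=\log(R'RK/\delta)$, $m=\lceil c_3L^2\ell/(\epsilon^2(1-\gamma)^4)\rceil$, $m_1=\lceil c_4L^2\ell/(1-\gamma)^2\rceil$, $\epsilon^{(i)}=c_5\frac{L}{1-\gamma}\sqrt{\ell/m}+c_6\frac{2^{-i}L}{1-\gamma}\sqrt{\ell/m_1}$,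 and $\theta^{(0,0)}=\{0\}$. For $i=0,\dots,R'$: for each $k$ draw $m$ fresh samples $x_k^{(l)}$ from $P(\cdot|s_k,a_k)$ and set $M^{(i,0)}(k)=\frac1m\sum_lV_{\theta^{(i,0)}}(x_k^{(l)})$; for $j=1,\dots,R$: for each $k$ draw $m_1$ fresh samples $x_k^{(l)}$ from $P(\cdot|s_k,a_k)$, set $M^{(i,j)}(k)=\frac1{m_1}\sum_l\big(V_{\theta^{(i,j-1)}}(x_k^{(l)})-V_{\theta^{(i,0)}}(x_k^{(l)})\big)+M^{(i,0)}(k)$, $\bar w^{(i,j)}=\Phi^{-1}M^{(i,j)}-\epsilon^{(i)}\mathbf 1$ and $\theta^{(i,j)}=\theta^{(i,j-1)}\cup\{\bar w^{(i,j)}\}$; then set $\theta^{(i+1,0)}=\theta^{(i,R)}$. The output is $\theta^{(R',R)}$. Two-sided algorithm. Run the one-sided algorithm on $\mathcal M$, with output $\theta$, and, with independent samples, on the flipped game $\mathcal M'$ (rewards $1-r$, same transitions, the objectives of the two players switched), with output $\eta$. The output is the strategy $\pi$ with $\pi(s)=\pi_\theta(s)$ on $\mathcal S_1$ and $\pi(s)=\pi'_\eta(s)$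 on $\mathcal S_2$, where $\pi'_\eta$ is formed in $\mathcal M'$. Theorem. There are absolute constants $c_1,\dots,c_6,C>0$ and $d\in\mathbb N$ such that for all $\mathcal M,K,\phi,(s_k,a_k)_k,L,\epsilon,\delta$ as above, with probability at least $1-2\delta$ the output of the two-sided algorithm is an $\epsilon$-optimal strategy, and the total number $N$ of samples drawn satisfies $$N\le C\,\frac{KL^2}{(1-\gamma)^4\epsilon^2}\Big(\log\frac{2K}{\epsilon\,\delta\,(1-\gamma)}\Big)^d .$$ -/

import Mathlib

open MeasureTheory ProbabilityTheory

noncomputable section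

/-- A discounted two-player zero-sum turn-based stochastic game. `A s` is the set of actions available
at the state `s`; `isMax s = true` says that `s` is controlled by the player who maximizes the
discounted reward, `isMax s = false` that it is controlled by the player who minimizes it. -/
structure TBSG (S : Type*) (A : S → Type*) where
  isMax : S → Bool
  P : (s : S) → A s → PMF S
  r : (s : S) → A s → ℝ
  γ : ℝ
  r_mem : ∀ s a, r s a ∈ Set.Icc (0 : ℝ) 1
  γ_nonneg : 0 ≤ γ
  γ_lt_one : γ < 1

namespace TBSG

variable {S : Type*} {A : S → Type*}

/-! ### Strategies, values, equilibria -/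

/-- A (deterministic, stationary) strategy pair, given as one selector. The strategy of player 1 (the
maximizer) is its restriction to the states with `isMax s = true`, that of player 2 its restriction
to the other states. -/
abbrev Strategy (A : S → Type*) := (s : S) → A s

/-- The strategy pair `(π₁, π₂)`: player 1 plays as in `π₁`, player 2 plays as in `π₂`. -/
def pair (M : TBSG S A) (π₁ π₂ : Strategy A) : Strategy A :=
  fun s => if M.isMax s then π₁ s else π₂ s

section Value

variable [Countable S] [MeasurableSpace S] [MeasurableSingletonClass S]

/-- The one-step transition kernel of the Markov chain of states under the strategy pair `π`. -/
def stepKernel (M : TBSG S A) (π : Strategy A) : Kernel S S where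
  toFun s := (M.P s (π s)).toMeasure
  measurable' := measurable_of_countable _

instance (M : TBSG S A) (π : Strategy A) : IsMarkovKernel (M.stepKernel π) :=
  ⟨fun s => inferInstanceAs (IsProbabilityMeasure (M.P s (π s)).toMeasure)⟩

/-- The same transitions, as a kernel that reads the whole history up to time `n`. -/
def histKernel (M : TBSG S A) (π : Strategy A) (n : ℕ) :
    Kernel ((i : Finset.Iic n) → (fun _ : ℕ => S) i) S :=
  (M.stepKernel π).comap (fun h => h ⟨n, Finset.mem_Iic.2 le_rfl⟩) (measurable_pi_apply _)

instance (M : TBSG S A) (π : Strategy A) (n : ℕ) : IsMarkovKernel (M.histKernel π n) :=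
  inferInstanceAs (IsMarkovKernel (Kernel.comap _ _ _))

/-- The law of the trajectory `(s₀, s₁, s₂, …)` with `s₀ = s` under the strategy pair `π`. -/
def trajLaw (M : TBSG S A) (π : Strategy A) (s : S) : Measure (ℕ → S) :=
  Kernel.traj (X := fun _ => S) (M.histKernel π) 0 (fun _ => s)

/-- The value function of `π`: expected total discounted reward. -/
def value (M : TBSG S A) (π : Strategy A) (s : S) : ℝ :=
  ∫ ω, ∑' i : ℕ, M.γ ^ i * M.r (ω i) (π (ω i)) ∂(M.trajLaw π s)

/-- Nash equilibrium strategy pairs. -/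
def IsEquilibrium (M : TBSG S A) (π : Strategy A) : Prop :=
  ∀ (σ : Strategy A) (s : S),
    M.value (M.pair σ π) s ≤ M.value π s ∧ M.value π s ≤ M.value (M.pair π σ) s

/-- `v` is the equilibrium value function: the value function of an equilibrium strategy. -/
def IsEquilibriumValue (M : TBSG S A) (v : S → ℝ) : Prop :=
  ∃ π : Strategy A, M.IsEquilibrium π ∧ M.value π = v

/-- `ε`-optimal strategy pairs: no deviation of player 1 gains, and no deviation of player 2 takes
away, more than `ε` with respect to the equilibrium value, at any state. -/
def IsEpsOptimal (M : TBSG S A) (ε : ℝ) (π : Strategy A) : Prop :=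
  ∃ v : S → ℝ, M.IsEquilibriumValue v ∧ ∀ s : S,
    (∀ σ : Strategy A, M.value (M.pair σ π) s - v s ≤ ε) ∧
    (∀ σ : Strategy A, -ε ≤ M.value (M.pair π σ) s - v s)

end Value

/-- The flipped game: rewards `1 - r`, same transitions, and the objectives of the two players are
switched. -/
def flip (M : TBSG S A) : TBSG S A where
  isMax s := !M.isMax s
  P := M.P
  r s a := 1 - M.r s a
  γ := M.γ
  r_mem s a := ⟨by linarith [(M.r_mem s a).2], by linarith [(M.r_mem s a).1]⟩
  γ_nonneg := M.γ_nonneg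
  γ_lt_one := M.γ_lt_one

/-! ### Features -/

/-- `K` features of the state-action pairs. -/
abbrev Features (A : S → Type*) (K : ℕ) := (s : S) → A s → Fin K → ℝ

/-- The transition model can be embedded into the feature space. -/
def Embeds {K : ℕ} (M : TBSG S A) (φ : Features A K) : Prop :=
  ∃ ψ : Fin K → S → ℝ, ∀ s a s', (M.P s a s').toReal = ∑ k, φ s a k * ψ k s'

/-- The `K × K` matrix whose rows are the feature vectors of the anchor pairs. -/
def anchorMatrix {K : ℕ} (φ : Features A K) (𝒦 : Fin K → (s : S) × A s) :
    Matrix (Fin K) (Fin K) ℝ :=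
  fun k l => φ (𝒦 k).1 (𝒦 k).2 l

/-- All feature vectors have `ℓ¹` norm at most one, and the anchor matrix is invertible with
`‖Φ⁻¹‖_∞ ≤ L` (operator norm for the sup norm: the largest absolute row sum). -/
def AnchorBound {K : ℕ} (φ : Features A K) (𝒦 : Fin K → (s : S) × A s) (L : ℝ) : Prop :=
  (∀ s a, ∑ k, |φ s a k| ≤ 1) ∧ 0 < L ∧ IsUnit (anchorMatrix φ 𝒦) ∧
    ∀ k, ∑ l, |(anchorMatrix φ 𝒦)⁻¹ k l| ≤ L

/-! ### Max-linear parametrization -/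

/-- `Q_w(s, a) = r(s, a) + γ φ(s, a)ᵀ w`. -/
def Q {K : ℕ} (M : TBSG S A) (φ : Features A K) (w : Fin K → ℝ) (s : S) (a : A s) : ℝ :=
  M.r s a + M.γ * ∑ k, φ s a k * w k

/-- The best value of `Q_w(s, ·)` for the player who controls `s`. -/
def optQ {K : ℕ} (M : TBSG S A) (φ : Features A K) (w : Fin K → ℝ) (s : S) : ℝ :=
  if M.isMax s then ⨆ a : A s, M.Q φ w s a else ⨅ a : A s, M.Q φ w s a

/-- `V_θ(s)`, the maximum over `w ∈ θ` of the preceding values. -/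
def V {K : ℕ} (M : TBSG S A) (φ : Features A K) (θ : Finset (Fin K → ℝ)) (s : S) : ℝ :=
  ⨆ w : {w // w ∈ θ}, M.optQ φ w s

/-- `a` is a possible value of `π_θ(s)`: an optimal action for a maximizing `w ∈ θ`. -/
def IsGreedy {K : ℕ} (M : TBSG S A) (φ : Features A K) (θ : Finset (Fin K → ℝ)) (s : S)
    (a : A s) : Prop :=
  ∃ w ∈ θ, M.optQ φ w s = M.V φ θ s ∧ M.Q φ w s a = M.optQ φ w s

/-! ### The algorithms -/

/-- Parameters of a run: numbers of outer and inner iterations, batch sizes, and the downward shift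
`ε⁽ⁱ⁾` of the `i`-th outer iteration. -/
structure RunParams where
  R' : ℕ
  R : ℕ
  m : ℕ
  m₁ : ℕ
  shift : ℕ → ℝ

/-- The constants hidden in the choice of the parameters. -/
structure HiddenConsts where
  cR' : ℝ
  cR : ℝ
  cm : ℝ
  cm₁ : ℝ
  cε₁ : ℝ
  cε₂ : ℝ

def HiddenConsts.Pos (c : HiddenConsts) : Prop :=
  0 < c.cR' ∧ 0 < c.cR ∧ 0 < c.cm ∧ 0 < c.cm₁ ∧ 0 < c.cε₁ ∧ 0 < c.cε₂

/-- The parameters chosen for the discount factor `γ`, the number `K` of features, the bound `L`, the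
accuracy `ε` and the confidence `δ`. -/
def runParams (c : HiddenConsts) (γ : ℝ) (K : ℕ) (L ε δ : ℝ) : RunParams :=
  let R' : ℕ := ⌈c.cR' * Real.log (1 / (ε * (1 - γ)))⌉₊
  let R : ℕ := ⌈c.cR * (R' / (1 - γ))⌉₊
  let ℓ : ℝ := Real.log (R' * R * K / δ)
  let m : ℕ := ⌈c.cm * (L ^ 2 * ℓ / (ε ^ 2 * (1 - γ) ^ 4))⌉₊
  let m₁ : ℕ := ⌈c.cm₁ * (L ^ 2 * ℓ / (1 - γ) ^ 2)⌉₊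
  { R' := R'
    R := R
    m := m
    m₁ := m₁
    shift := fun i => c.cε₁ * (L / (1 - γ) * √(ℓ / m)) +
      c.cε₂ * (L * 2⁻¹ ^ i / (1 - γ) * √(ℓ / m₁)) }

/-- Labels of the samples drawn at one anchor pair within one outer iteration: the `m` samples of the
reference estimate, and the `m₁` samples of each of the `R` inner iterations. -/
abbrev LocalDraw (p : RunParams) := Fin p.m ⊕ (Fin p.R × Fin p.m₁)

/-- Labels of the samples drawn in a run of the one-sided algorithm, whose outer iterations are
`i = 0, …, R'`. -/
abbrev RunDraw (K : ℕ) (p : RunParams) := Fin (p.R' + 1) × Fin K × LocalDraw p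

/-- Labels of all samples drawn by the two-sided algorithm: one run for the game (`0`), and one for
the flipped game (`1`). -/
abbrev Draw (K : ℕ) (p : RunParams) := Fin 2 × RunDraw K p

/-- The number of samples used by the two-sided algorithm. -/
def sampleCount (K : ℕ) (p : RunParams) : ℕ := Fintype.card (Draw K p)

/-- The law of the samples: independent, those with anchor label `k` distributed as
`P(· | s_k, a_k)`. -/
def sampleLaw {K : ℕ} [MeasurableSpace S] (M : TBSG S A) (𝒦 : Fin K → (s : S) × A s)
    (p : RunParams) : Measure (Draw K p → S) :=
  Measure.pi fun q => (M.P (𝒦 q.2.2.1).1 (𝒦 q.2.2.1).2).toMeasure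

section Run

variable {K : ℕ} (M : TBSG S A) (φ : Features A K) (𝒦 : Fin K → (s : S) × A s) (p : RunParams)

/-- The reference estimate `M⁽ⁱ'⁰⁾`, where `θ₀` is `θ⁽ⁱ'⁰⁾` and `x` holds the samples of the `i`-th
outer iteration. -/
def refEstimate (θ₀ : Finset (Fin K → ℝ)) (x : Fin K → LocalDraw p → S) (k : Fin K) : ℝ :=
  1 / p.m * ∑ l : Fin p.m, M.V φ θ₀ (x k (.inl l))

/-- The variance-reduced estimate of an inner iteration, with previous parameter `θ`. -/
def vrEstimate (θ₀ : Finset (Fin K → ℝ)) (x : Fin K → LocalDraw p → S) (j : Fin p.R)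
    (θ : Finset (Fin K → ℝ)) (k : Fin K) : ℝ :=
  1 / p.m₁ * ∑ l : Fin p.m₁, (M.V φ θ (x k (.inr (j, l))) - M.V φ θ₀ (x k (.inr (j, l)))) +
    M.refEstimate φ p θ₀ x k

/-- The new parameter vector of an inner iteration, shifted downwards by `e`. -/
def newVector (e : ℝ) (θ₀ : Finset (Fin K → ℝ)) (x : Fin K → LocalDraw p → S) (j : Fin p.R)
    (θ : Finset (Fin K → ℝ)) : Fin K → ℝ :=
  fun k => ((anchorMatrix φ 𝒦)⁻¹.mulVec (M.vrEstimate φ p θ₀ x j θ)) k - e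

/-- `θ⁽ⁱ'ʲ⁾` for `j = 0, …, R`, starting from `θ₀ = θ⁽ⁱ'⁰⁾`. -/
def innerParam (e : ℝ) (θ₀ : Finset (Fin K → ℝ)) (x : Fin K → LocalDraw p → S) (j : Fin (p.R + 1)) :
    Finset (Fin K → ℝ) :=
  Fin.induction (motive := fun _ => Finset (Fin K → ℝ)) θ₀
    (fun j θ => θ ∪ {M.newVector φ 𝒦 p e θ₀ x j θ}) j

/-- `θ⁽ⁱ'⁰⁾` for `i = 0, …, R' + 1`, where `θ⁽⁰'⁰⁾ = {0}` and `θ⁽ⁱ⁺¹'⁰⁾ = θ⁽ⁱ'ᴿ⁾`. -/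
def outerParam (x : RunDraw K p → S) (i : Fin (p.R' + 1 + 1)) : Finset (Fin K → ℝ) :=
  Fin.induction (motive := fun _ => Finset (Fin K → ℝ)) {0}
    (fun i θ₀ => M.innerParam φ 𝒦 p (p.shift i) θ₀ (fun k d => x (i, k, d)) (Fin.last p.R)) i

/-- The output of the one-sided variance-reduced Q-learning algorithm on the samples `x`: the
parameter at the end of the last outer iteration `i = R'`. -/
def oneSided (x : RunDraw K p → S) : Finset (Fin K → ℝ) :=
  M.outerParam φ 𝒦 p x (Fin.last (p.R' + 1))

/-- `π` is an output of the two-sided algorithm on the samples `x`: it plays greedily with respect to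
the output for the game at the states of player 1, and with respect to the output for the flipped
game at the states of player 2. Ties may be broken in any way. -/
def IsTwoSidedOutput (x : Draw K p → S) (π : Strategy A) : Prop :=
  ∀ s : S,
    if M.isMax s then M.IsGreedy φ (M.oneSided φ 𝒦 p fun q => x (0, q)) s (π s)
    else M.flip.IsGreedy φ (M.flip.oneSided φ 𝒦 p fun q => x (1, q)) s (π s)

end Run

end TBSG

end

noncomputable section

namespace TBSG

set_option linter.unusedSectionVars false

section

variable {S : Type*} {A : S → Type*}

/-! ### One-player optimization over a finite set -/

/-- The best value of `f` for the maximizer (`b = true`) or the minimizer (`b = false`). -/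
def playerOpt {α : Type*} (b : Bool) (f : α → ℝ) : ℝ := if b then ⨆ a, f a else ⨅ a, f a

section PlayerOpt

variable {α : Type*} [Finite α] {b : Bool} {f g : α → ℝ}

theorem le_playerOpt_true (f : α → ℝ) (a : α) : f a ≤ playerOpt true f :=
  le_ciSup (Set.finite_range f).bddAbove a

theorem playerOpt_false_le (f : α → ℝ) (a : α) : playerOpt false f ≤ f a :=
  ciInf_le (Set.finite_range f).bddBelow a

variable [Nonempty α]

theorem exists_eq_playerOpt (b : Bool) (f : α → ℝ) : ∃ a, f a = playerOpt b f := by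
  cases b
  · exact exists_eq_ciInf_of_finite
  · exact exists_eq_ciSup_of_finite

theorem playerOpt_le_add {c : ℝ} (h : ∀ a, f a ≤ g a + c) : playerOpt b f ≤ playerOpt b g + c := by
  cases b
  · obtain ⟨a, ha⟩ := exists_eq_playerOpt false g
    rw [← ha]
    exact (playerOpt_false_le f a).trans (h a)
  · obtain ⟨a, ha⟩ := exists_eq_playerOpt true f
    rw [← ha]
    have := le_playerOpt_true g a
    linarith [h a]

theorem playerOpt_mono (h : ∀ a, f a ≤ g a) : playerOpt b f ≤ playerOpt b g := by
  simpa using playerOpt_le_add (b := b) (c := 0) (by simpa using h)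

theorem playerOpt_const_sub (b : Bool) (c : ℝ) (f : α → ℝ) :
    playerOpt (!b) (fun a => c - f a) = c - playerOpt b f := by
  cases b
  · apply le_antisymm
    · obtain ⟨a, ha⟩ := exists_eq_playerOpt true (fun a => c - f a)
      have := playerOpt_false_le f a
      simp only [Bool.not_false]
      rw [← ha]; linarith
    · obtain ⟨a, ha⟩ := exists_eq_playerOpt false f
      rw [← ha]
      exact le_playerOpt_true (fun a => c - f a) a
  · apply le_antisymm
    · obtain ⟨a, ha⟩ := exists_eq_playerOpt true f
      rw [← ha]
      exact playerOpt_false_le (fun a => c - f a) a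
    · obtain ⟨a, ha⟩ := exists_eq_playerOpt false (fun a => c - f a)
      have := le_playerOpt_true f a
      simp only [Bool.not_true]
      rw [← ha]; linarith

end PlayerOpt

/-! ### Bounded functions and their expectations -/

/-- Two-sided boundedness of a real function. -/
def Bdd (f : S → ℝ) : Prop := ∃ C, ∀ s, |f s| ≤ C

theorem Bdd.sub {f g : S → ℝ} (hf : Bdd f) (hg : Bdd g) : Bdd fun s => f s - g s := by
  obtain ⟨C, hC⟩ := hf
  obtain ⟨D, hD⟩ := hg
  exact ⟨C + D, fun s => (abs_sub _ _).trans (add_le_add (hC s) (hD s))⟩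

theorem bdd_of_mem_Icc {f : S → ℝ} {a b : ℝ} (h : ∀ s, f s ∈ Set.Icc a b) : Bdd f :=
  ⟨max |a| |b|, fun s => abs_le_max_abs_abs (h s).1 (h s).2⟩

theorem bdd_const (c : ℝ) : Bdd fun _ : S => c := ⟨|c|, fun _ => le_rfl⟩

theorem one_sub_γ_pos (M : TBSG S A) : 0 < 1 - M.γ := by linarith [M.γ_lt_one]

section Bellman

variable [Countable S] [MeasurableSpace S] [MeasurableSingletonClass S]

theorem Bdd.integrable {f : S → ℝ} (hf : Bdd f) (μ : Measure S) [IsFiniteMeasure μ] :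
    Integrable f μ := by
  obtain ⟨C, hC⟩ := hf
  exact Integrable.of_bound (measurable_of_countable f).aestronglyMeasurable C
    (Filter.Eventually.of_forall hC)

/-- Expected value of `g` at the next state. -/
def expect (M : TBSG S A) (s : S) (a : A s) (g : S → ℝ) : ℝ := ∫ s', g s' ∂(M.P s a).toMeasure

/-- Reward of the action `a` plus the discounted expectation of `g` at the next state. -/
def backup (M : TBSG S A) (g : S → ℝ) (s : S) (a : A s) : ℝ := M.r s a + M.γ * M.expect s a g

/-- The Bellman (Shapley) operator. -/
def bellman (M : TBSG S A) (g : S → ℝ) (s : S) : ℝ := playerOpt (M.isMax s) (M.backup g s)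

variable (M : TBSG S A)

@[simp]
theorem expect_const (s : S) (a : A s) (c : ℝ) : M.expect s a (fun _ => c) = c := by
  simp [expect]

theorem expect_sub {f g : S → ℝ} (hf : Bdd f) (hg : Bdd g) (s : S) (a : A s) :
    M.expect s a (fun x => f x - g x) = M.expect s a f - M.expect s a g :=
  integral_sub (hf.integrable _) (hg.integrable _)

theorem expect_le_add {f g : S → ℝ} (hf : Bdd f) (hg : Bdd g) {c : ℝ} (h : ∀ x, f x ≤ g x + c)
    (s : S) (a : A s) : M.expect s a f ≤ M.expect s a g + c := by
  have h1 : M.expect s a f ≤ M.expect s a (fun x => g x + c) :=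
    integral_mono (hf.integrable _) ((hg.integrable _).add (integrable_const c)) h
  have h2 : M.expect s a (fun x => g x + c) = M.expect s a g + c := by
    unfold expect
    rw [integral_add (hg.integrable _) (integrable_const c)]
    simp
  linarith

theorem backup_le_add {f g : S → ℝ} (hf : Bdd f) (hg : Bdd g) {c : ℝ} (h : ∀ x, f x ≤ g x + c)
    (s : S) (a : A s) : M.backup f s a ≤ M.backup g s a + M.γ * c := by
  have := mul_le_mul_of_nonneg_left (M.expect_le_add hf hg h s a) M.γ_nonneg
  unfold backup
  linarith

theorem backup_mono {f g : S → ℝ} (hf : Bdd f) (hg : Bdd g) (h : ∀ x, f x ≤ g x)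
    (s : S) (a : A s) : M.backup f s a ≤ M.backup g s a := by
  simpa using M.backup_le_add hf hg (c := 0) (by simpa using h) s a

theorem flip_backup {v : S → ℝ} (hv : Bdd v) (s : S) (a : A s) :
    M.flip.backup (fun x => 1 / (1 - M.γ) - v x) s a = 1 / (1 - M.γ) - M.backup v s a := by
  have hγ := M.one_sub_γ_pos
  have h : M.flip.expect s a (fun x => 1 / (1 - M.γ) - v x) = 1 / (1 - M.γ) - M.expect s a v := by
    rw [expect_sub _ (bdd_const _) hv, expect_const]
    rfl
  have h1 : 1 / (1 - M.γ) = 1 + M.γ * (1 / (1 - M.γ)) := by field_simp; ring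
  have h2 : M.flip.backup (fun x => 1 / (1 - M.γ) - v x) s a =
    1 - M.r s a + M.γ * M.flip.expect s a (fun x => 1 / (1 - M.γ) - v x) := rfl
  rw [h2, h, backup]
  linarith

variable [∀ s, Finite (A s)] [∀ s, Nonempty (A s)]

theorem bellman_le_add {f g : S → ℝ} (hf : Bdd f) (hg : Bdd g) {c : ℝ} (h : ∀ x, f x ≤ g x + c)
    (s : S) : M.bellman f s ≤ M.bellman g s + M.γ * c :=
  playerOpt_le_add fun a => M.backup_le_add hf hg h s a

theorem Bdd.bellman {f : S → ℝ} (hf : Bdd f) : Bdd (M.bellman f) := by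
  obtain ⟨C, hC⟩ := id hf
  refine ⟨1 + M.γ * C, fun s => ?_⟩
  obtain ⟨a, ha⟩ := exists_eq_playerOpt (M.isMax s) (M.backup f s)
  have h1 := M.expect_le_add hf (bdd_const 0) (c := C) (fun x => by linarith [(abs_le.1 (hC x)).2]) s a
  have h2 := M.expect_le_add (bdd_const 0) hf (c := C) (fun x => by linarith [(abs_le.1 (hC x)).1]) s a
  rw [expect_const] at h1 h2
  have h3 := mul_le_mul_of_nonneg_left h1 M.γ_nonneg
  have h4 := mul_le_mul_of_nonneg_left h2 M.γ_nonneg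
  have h5 := M.r_mem s a
  rw [TBSG.bellman, ← ha, backup, abs_le]
  constructor <;> linarith [h5.1, h5.2]

theorem le_of_tendsto_pow_mul {γ a b D : ℝ} (h0 : 0 ≤ γ) (h1 : γ < 1)
    (h : ∀ n : ℕ, a ≤ b + γ ^ n * D) : a ≤ b := by
  refine ge_of_tendsto' (x := Filter.atTop) ?_ h
  simpa using ((tendsto_pow_atTop_nhds_zero_of_lt_one h0 h1).mul_const D).const_add b

/-- A bounded sub-solution of the Bellman equation lies below every bounded super-solution. -/
theorem le_of_le_bellman_of_bellman_le {u v : S → ℝ} (hu : Bdd u) (hv : Bdd v)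
    (h1 : ∀ s, u s ≤ M.bellman u s) (h2 : ∀ s, M.bellman v s ≤ v s) (s : S) : u s ≤ v s := by
  obtain ⟨D, hD⟩ := hu.sub hv
  refine le_of_tendsto_pow_mul (D := D) M.γ_nonneg M.γ_lt_one fun n => ?_
  induction n generalizing s with
  | zero => linarith [(abs_le.1 (hD s)).2]
  | succ n ih =>
    calc u s ≤ M.bellman u s := h1 s
      _ ≤ M.bellman v s + M.γ * (M.γ ^ n * D) := M.bellman_le_add hu hv ih s
      _ ≤ v s + M.γ ^ (n + 1) * D := by rw [pow_succ]; linarith [h2 s]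

theorem exists_bellman_fixedPoint : ∃ v : S → ℝ, Bdd v ∧ ∀ s, M.bellman v s = v s := by
  let : TopologicalSpace S := ⊥
  have : DiscreteTopology S := ⟨rfl⟩
  have hB : ∀ f : BoundedContinuousFunction S ℝ, Bdd f := fun f => ⟨‖f‖, f.norm_coe_le_norm⟩
  have hT : ∀ f : BoundedContinuousFunction S ℝ, Bdd (M.bellman f) := fun f => (hB f).bellman M
  choose C hC using hT
  let T : BoundedContinuousFunction S ℝ → BoundedContinuousFunction S ℝ := fun f =>
    BoundedContinuousFunction.ofNormedAddCommGroupDiscrete (M.bellman f) (C f) (hC f)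
  obtain ⟨κ, hκ⟩ : ∃ κ : NNReal, (κ : ℝ) = M.γ := ⟨M.γ.toNNReal, Real.coe_toNNReal _ M.γ_nonneg⟩
  have hTl : LipschitzWith κ T := by
    refine LipschitzWith.of_dist_le_mul fun f g => ?_
    rw [hκ, BoundedContinuousFunction.dist_le (mul_nonneg M.γ_nonneg dist_nonneg)]
    intro s
    have hfg : ∀ x, |f x - g x| ≤ dist f g := fun x => f.dist_coe_le_dist x
    have h1 := M.bellman_le_add (hB f) (hB g) (c := dist f g)
      (fun x => by linarith [(abs_le.1 (hfg x)).2]) s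
    have h2 := M.bellman_le_add (hB g) (hB f) (c := dist f g)
      (fun x => by linarith [(abs_le.1 (hfg x)).1]) s
    change |M.bellman f s - M.bellman g s| ≤ M.γ * dist f g
    rw [abs_le]
    constructor <;> linarith
  have hc : ContractingWith κ T := ⟨by rw [← NNReal.coe_lt_coe, hκ]; exact M.γ_lt_one, hTl⟩
  refine ⟨hc.fixedPoint, hB _, fun s => ?_⟩
  have := hc.fixedPoint_isFixedPt
  exact congrArg (fun f : BoundedContinuousFunction S ℝ => f s) this

theorem mem_Icc_of_bellman_eq {v : S → ℝ} (hv : Bdd v) (h : ∀ s, M.bellman v s = v s) (s : S) :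
    v s ∈ Set.Icc 0 (1 / (1 - M.γ)) := by
  have hγ := M.one_sub_γ_pos
  constructor
  · refine M.le_of_le_bellman_of_bellman_le (u := fun _ => 0) (bdd_const 0) hv (fun s => ?_)
      (fun s => (h s).le) s
    obtain ⟨a, ha⟩ := exists_eq_playerOpt (M.isMax s) (M.backup (fun _ => 0) s)
    rw [bellman, ← ha, backup, expect_const]
    linarith [(M.r_mem s a).1]
  · refine M.le_of_le_bellman_of_bellman_le (v := fun _ => 1 / (1 - M.γ)) hv (bdd_const _)
      (fun s => (h s).ge) (fun s => ?_) s
    obtain ⟨a, ha⟩ := exists_eq_playerOpt (M.isMax s) (M.backup (fun _ => 1 / (1 - M.γ)) s)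
    rw [bellman, ← ha, backup, expect_const]
    have : 1 / (1 - M.γ) = 1 + M.γ * (1 / (1 - M.γ)) := by field_simp; ring
    linarith [(M.r_mem s a).2]

theorem flip_bellman {v : S → ℝ} (hv : Bdd v) (s : S) :
    M.flip.bellman (fun x => 1 / (1 - M.γ) - v x) s = 1 / (1 - M.γ) - M.bellman v s := by
  unfold bellman
  rw [funext (M.flip_backup hv s)]
  exact playerOpt_const_sub _ _ _

end Bellman

end

section

variable {S : Type*} {A : S → Type*}

section Trajectory

variable [Countable S] [MeasurableSpace S] [MeasurableSingletonClass S] (M : TBSG S A)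

instance (π : Strategy A) (s : S) : IsProbabilityMeasure (M.trajLaw π s) := by
  unfold trajLaw; infer_instance

theorem measurable_of_countable_coord (f : S → ℝ) (n : ℕ) :
    Measurable fun ω : ℕ → S => f (ω n) :=
  (measurable_of_countable f).comp (measurable_pi_apply n)

theorem Bdd.integrable_coord {f : S → ℝ} (hf : Bdd f) (π : Strategy A) (s : S) (n : ℕ) :
    Integrable (fun ω : ℕ → S => f (ω n)) (M.trajLaw π s) := by
  obtain ⟨C, hC⟩ := hf
  exact Integrable.of_bound (measurable_of_countable_coord f n).aestronglyMeasurable C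
    (Filter.Eventually.of_forall fun ω => hC (ω n))

theorem integral_trajLaw_zero (π : Strategy A) (s : S) (f : S → ℝ) :
    ∫ ω, f (ω 0) ∂M.trajLaw π s = f s := by
  have h := Kernel.traj_map_frestrictLe_apply (X := fun _ => S) (κ := M.histKernel π) 0 0
    (fun _ => s)
  rw [Kernel.partialTraj_self, Kernel.id_apply] at h
  let g : ((i : Finset.Iic 0) → (fun _ : ℕ => S) i) → ℝ := fun y => f (y ⟨0, Finset.mem_Iic.2 le_rfl⟩)
  have hg : Measurable g := (measurable_of_countable f).comp (measurable_pi_apply _)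
  have h2 : ∫ y, g y ∂((Kernel.traj (X := fun _ => S) (M.histKernel π) 0 (fun _ => s)).map
      (Preorder.frestrictLe 0)) = ∫ ω, f (ω 0) ∂M.trajLaw π s :=
    integral_map (by fun_prop) hg.aestronglyMeasurable
  rw [← h2, h, integral_dirac' _ _ hg.stronglyMeasurable]

theorem integral_trajLaw_succ (π : Strategy A) (s : S) (n : ℕ) {f : S → ℝ} (hf : Bdd f) :
    ∫ ω, f (ω (n + 1)) ∂M.trajLaw π s =
      ∫ ω, M.expect (ω n) (π (ω n)) f ∂M.trajLaw π s := by
  have h := Kernel.partialTraj_compProd_eq_map_traj (X := fun _ => S) (κ := M.histKernel π)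
    (Nat.zero_le n) (x₀ := fun _ => s)
  obtain ⟨C, hC⟩ := id hf
  let X : ℕ → Type _ := fun _ => S
  let g : ((i : Finset.Iic n) → X i) × S → ℝ := fun y => f y.2
  have hg : Measurable g := (measurable_of_countable f).comp measurable_snd
  have h2 : ∫ y, g y ∂((Kernel.traj (X := fun _ => S) (M.histKernel π) 0 (fun _ => s)).map
      (fun x => (Preorder.frestrictLe n x, x (n + 1)))) = ∫ ω, f (ω (n + 1)) ∂M.trajLaw π s :=
    integral_map (by fun_prop) hg.aestronglyMeasurable
  rw [← h2, ← h, Measure.integral_compProd]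
  · rw [← Kernel.traj_map_frestrictLe_apply (X := fun _ => S), integral_map (by fun_prop)]
    · rfl
    · refine Measurable.aestronglyMeasurable ?_
      exact (measurable_of_countable fun t => M.expect t (π t) f).comp
        (measurable_pi_apply (⟨n, Finset.mem_Iic.2 le_rfl⟩ : Finset.Iic n))
  · exact Integrable.of_bound hg.aestronglyMeasurable C
      (Filter.Eventually.of_forall fun y => hC y.2)

theorem abs_discounted_le (π : Strategy A) (ω : ℕ → S) (i : ℕ) :
    |M.γ ^ i * M.r (ω i) (π (ω i))| ≤ M.γ ^ i := by
  have h := M.r_mem (ω i) (π (ω i))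
  have h2 := pow_nonneg M.γ_nonneg i
  rw [abs_mul, abs_of_nonneg h2, abs_of_nonneg h.1]
  exact mul_le_of_le_one_right h2 h.2

theorem bdd_reward (π : Strategy A) : Bdd fun s => M.r s (π s) :=
  bdd_of_mem_Icc fun s => M.r_mem s (π s)

theorem hasSum_value (π : Strategy A) (s : S) :
    HasSum (fun i : ℕ => M.γ ^ i * ∫ ω, M.r (ω i) (π (ω i)) ∂M.trajLaw π s) (M.value π s) := by
  have hs := summable_geometric_of_lt_one M.γ_nonneg M.γ_lt_one
  have h := hasSum_integral_of_summable_integral_norm (μ := M.trajLaw π s)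
    (F := fun i ω => M.γ ^ i * M.r (ω i) (π (ω i)))
    (fun i => ((M.bdd_reward π).integrable_coord M π s i).const_mul _)
    (Summable.of_nonneg_of_le (fun i => integral_nonneg fun ω => norm_nonneg _) (fun i => by
      calc ∫ ω, ‖M.γ ^ i * M.r (ω i) (π (ω i))‖ ∂M.trajLaw π s
          ≤ ∫ _, M.γ ^ i ∂M.trajLaw π s := by
            refine integral_mono
              (((M.bdd_reward π).integrable_coord M π s i).const_mul _).norm
              (integrable_const _) fun ω => M.abs_discounted_le π ω i
        _ = M.γ ^ i := by simp) hs)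
  simp only [integral_const_mul] at h
  exact h

variable {M}

/-- A bounded function below its one-step backup under `π` lies below the value of `π`. -/
theorem le_value {π : Strategy A} {u : S → ℝ} (hu : Bdd u)
    (h : ∀ s, u s ≤ M.backup u s (π s)) (s : S) : u s ≤ M.value π s := by
  obtain ⟨D, hD⟩ := id hu
  have hE : Bdd fun t => M.expect t (π t) u := ⟨D, fun t => by
    have h1 := M.expect_le_add hu (bdd_const 0) (c := D)
      (fun x => by linarith [(abs_le.1 (hD x)).2]) t (π t)
    have h2 := M.expect_le_add (bdd_const 0) hu (c := D)
      (fun x => by linarith [(abs_le.1 (hD x)).1]) t (π t)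
    rw [expect_const] at h1 h2
    exact abs_le.2 ⟨by linarith, by linarith⟩⟩
  have key : ∀ n : ℕ, u s ≤ ∑ i ∈ Finset.range n,
      M.γ ^ i * ∫ ω, M.r (ω i) (π (ω i)) ∂M.trajLaw π s +
        M.γ ^ n * ∫ ω, u (ω n) ∂M.trajLaw π s := by
    intro n
    induction n with
    | zero => simp [integral_trajLaw_zero]
    | succ n ih =>
      have h1 : ∫ ω, u (ω n) ∂M.trajLaw π s ≤ ∫ ω, M.r (ω n) (π (ω n)) ∂M.trajLaw π s +
          M.γ * ∫ ω, u (ω (n + 1)) ∂M.trajLaw π s := by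
        rw [M.integral_trajLaw_succ π s n hu, ← integral_const_mul, ← integral_add
          ((M.bdd_reward π).integrable_coord M π s n)
          ((hE.integrable_coord M π s n).const_mul _)]
        exact integral_mono (hu.integrable_coord M π s n)
          (((M.bdd_reward π).integrable_coord M π s n).add
            ((hE.integrable_coord M π s n).const_mul _)) fun ω => h (ω n)
      have h2 := mul_le_mul_of_nonneg_left h1 (pow_nonneg M.γ_nonneg n)
      rw [Finset.sum_range_succ, pow_succ]
      linarith
  have hlim : Filter.Tendsto (fun n : ℕ => ∑ i ∈ Finset.range n,
      M.γ ^ i * ∫ ω, M.r (ω i) (π (ω i)) ∂M.trajLaw π s + M.γ ^ n * D) Filter.atTop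
      (nhds (M.value π s + 0 * D)) :=
    (M.hasSum_value π s).tendsto_sum_nat.add
      ((tendsto_pow_atTop_nhds_zero_of_lt_one M.γ_nonneg M.γ_lt_one).mul_const D)
  have := ge_of_tendsto' hlim fun n => (key n).trans (by
    gcongr
    · exact pow_nonneg M.γ_nonneg n
    · calc ∫ ω, u (ω n) ∂M.trajLaw π s ≤ ∫ _, D ∂M.trajLaw π s :=
          integral_mono (hu.integrable_coord M π s n) (integrable_const _)
            fun ω => (abs_le.1 (hD (ω n))).2
        _ = D := by simp)
  simpa using this

variable (M) in
theorem flip_value (π : Strategy A) (s : S) :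
    M.flip.value π s = 1 / (1 - M.γ) - M.value π s := by
  have h1 := M.flip.hasSum_value π s
  have h2 := (hasSum_geometric_of_lt_one M.γ_nonneg M.γ_lt_one).sub (M.hasSum_value π s)
  rw [one_div]
  have he : (fun i : ℕ => M.flip.γ ^ i * ∫ ω, M.flip.r (ω i) (π (ω i)) ∂M.flip.trajLaw π s) =
      fun i : ℕ => M.γ ^ i - M.γ ^ i * ∫ ω, M.r (ω i) (π (ω i)) ∂M.trajLaw π s := by
    funext i
    have : ∫ ω, M.flip.r (ω i) (π (ω i)) ∂M.flip.trajLaw π s =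
        1 - ∫ ω, M.r (ω i) (π (ω i)) ∂M.trajLaw π s := by
      have h3 : ∫ ω, (1 - M.r (ω i) (π (ω i))) ∂M.trajLaw π s =
        1 - ∫ ω, M.r (ω i) (π (ω i)) ∂M.trajLaw π s := by
        rw [integral_sub (integrable_const _) ((M.bdd_reward π).integrable_coord M π s i)]
        simp
      exact h3
    rw [this]
    change M.γ ^ i * _ = _
    ring
  rw [he] at h1
  exact h1.unique h2

/-- A bounded function above its one-step backup under `π` lies above the value of `π`. -/
theorem value_le {π : Strategy A} {u : S → ℝ} (hu : Bdd u)
    (h : ∀ s, M.backup u s (π s) ≤ u s) (s : S) : M.value π s ≤ u s := by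
  have h1 := le_value (M := M.flip) (π := π) ((bdd_const (1 / (1 - M.γ))).sub hu)
    (fun t => by rw [flip_backup M hu]; linarith [h t]) s
  rw [flip_value] at h1
  linarith

end Trajectory

end

section

variable {S : Type*} {A : S → Type*}

section Equilibrium

variable [Countable S] [MeasurableSpace S] [MeasurableSingletonClass S]
  [∀ s, Finite (A s)] [∀ s, Nonempty (A s)] {M : TBSG S A}

theorem bellman_le_backup {v : S → ℝ} {s : S} (hs : M.isMax s = false) (a : A s) :
    M.bellman v s ≤ M.backup v s a := by
  rw [bellman, hs]; exact playerOpt_false_le _ a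

theorem backup_le_bellman {v : S → ℝ} {s : S} (hs : M.isMax s = true) (a : A s) :
    M.backup v s a ≤ M.bellman v s := by
  rw [bellman, hs]; exact le_playerOpt_true _ a

/-- A bounded fixed point of the Bellman operator is the equilibrium value. -/
theorem isEquilibriumValue_of_bellman_eq {v : S → ℝ} (hv : Bdd v)
    (h : ∀ s, M.bellman v s = v s) : M.IsEquilibriumValue v := by
  choose π hπ using fun s => exists_eq_playerOpt (M.isMax s) (M.backup v s)
  have hπ' : ∀ s, M.backup v s (π s) = v s := fun s => (hπ s).trans (h s)
  have hval : ∀ s, M.value π s = v s := fun s =>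
    le_antisymm (value_le hv (fun s => (hπ' s).le) s) (le_value hv (fun s => (hπ' s).ge) s)
  refine ⟨π, fun σ s => ⟨?_, ?_⟩, funext hval⟩
  · rw [hval]
    refine value_le hv (fun t => ?_) s
    cases ht : M.isMax t
    · simpa [pair, ht] using (hπ' t).le
    · simpa [pair, ht] using (backup_le_bellman ht (σ t)).trans (h t).le
  · rw [hval]
    refine le_value hv (fun t => ?_) s
    cases ht : M.isMax t
    · simpa [pair, ht] using (h t).ge.trans (bellman_le_backup ht (σ t))
    · simpa [pair, ht] using (hπ' t).ge

end Equilibrium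

/-! ### Max-linear functions -/

section MaxLinear

variable [∀ s, Finite (A s)] [∀ s, Nonempty (A s)] {K : ℕ} (M : TBSG S A) {φ : Features A K}
  {θ θ' : Finset (Fin K → ℝ)}

theorem optQ_eq_playerOpt (φ : Features A K) (w : Fin K → ℝ) (s : S) :
    M.optQ φ w s = playerOpt (M.isMax s) (M.Q φ w s) := rfl

theorem optQ_le_V {w : Fin K → ℝ} (hw : w ∈ θ) (s : S) : M.optQ φ w s ≤ M.V φ θ s :=
  le_ciSup (f := fun w : {w // w ∈ θ} => M.optQ φ w s) (Set.finite_range _).bddAbove ⟨w, hw⟩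

theorem exists_optQ_eq_V (φ : Features A K) (hθ : θ.Nonempty) (s : S) :
    ∃ w ∈ θ, M.optQ φ w s = M.V φ θ s := by
  have : Nonempty {w // w ∈ θ} := hθ.to_subtype
  obtain ⟨w, hw⟩ := exists_eq_ciSup_of_finite (f := fun w : {w // w ∈ θ} => M.optQ φ w s)
  exact ⟨w, w.2, hw⟩

theorem V_mono (hθ : θ.Nonempty) (h : θ ⊆ θ') (s : S) : M.V φ θ s ≤ M.V φ θ' s := by
  obtain ⟨w, hw, e⟩ := M.exists_optQ_eq_V φ hθ s
  rw [← e]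
  exact M.optQ_le_V (h hw) s

theorem exists_isGreedy (φ : Features A K) (hθ : θ.Nonempty) (s : S) :
    ∃ a, M.IsGreedy φ θ s a := by
  obtain ⟨w, hw, e⟩ := M.exists_optQ_eq_V φ hθ s
  obtain ⟨a, ha⟩ := exists_eq_playerOpt (M.isMax s) (M.Q φ w s)
  exact ⟨a, w, hw, e, ha⟩

theorem bdd_optQ (hφ : ∀ s a, ∑ k, |φ s a k| ≤ 1) (w : Fin K → ℝ) : Bdd (M.optQ φ w) := by
  refine ⟨1 + M.γ * ∑ k, |w k|, fun s => ?_⟩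
  obtain ⟨a, ha⟩ := exists_eq_playerOpt (M.isMax s) (M.Q φ w s)
  rw [optQ_eq_playerOpt, ← ha, Q]
  refine (abs_add_le _ _).trans (add_le_add ?_ ?_)
  · rw [abs_of_nonneg (M.r_mem s a).1]; exact (M.r_mem s a).2
  · rw [abs_mul, abs_of_nonneg M.γ_nonneg]
    refine mul_le_mul_of_nonneg_left ?_ M.γ_nonneg
    refine (Finset.abs_sum_le_sum_abs _ _).trans (Finset.sum_le_sum fun k _ => ?_)
    rw [abs_mul]
    refine mul_le_of_le_one_left (abs_nonneg _) (le_trans ?_ (hφ s a))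
    exact Finset.single_le_sum (f := fun k => |φ s a k|) (fun _ _ => abs_nonneg _)
      (Finset.mem_univ k)

theorem bdd_V (hφ : ∀ s a, ∑ k, |φ s a k| ≤ 1) (hθ : θ.Nonempty) : Bdd (M.V φ θ) := by
  choose C hC using fun w => M.bdd_optQ hφ w
  refine ⟨∑ w ∈ θ, |C w|, fun s => ?_⟩
  obtain ⟨w, hw, e⟩ := M.exists_optQ_eq_V φ hθ s
  rw [← e]
  exact ((hC w s).trans (le_abs_self _)).trans
    (Finset.single_le_sum (f := fun w => |C w|) (fun _ _ => abs_nonneg _) hw)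

end MaxLinear

section Pessimistic

variable [Countable S] [MeasurableSpace S] [MeasurableSingletonClass S]
  [∀ s, Finite (A s)] [∀ s, Nonempty (A s)] {K : ℕ} {M : TBSG S A} {φ : Features A K}
  {θ : Finset (Fin K → ℝ)} {v : S → ℝ}

/-- The parameter contains `0`, and each of its linear functions lies below the one-step backup of
its value function. -/
def Pessimistic (M : TBSG S A) (φ : Features A K) (θ : Finset (Fin K → ℝ)) : Prop :=
  0 ∈ θ ∧ ∀ w ∈ θ, ∀ s a, M.Q φ w s a ≤ M.backup (M.V φ θ) s a

theorem V_nonneg (h : 0 ∈ θ) (s : S) : 0 ≤ M.V φ θ s := by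
  refine le_trans ?_ (M.optQ_le_V h s)
  obtain ⟨a, ha⟩ := exists_eq_playerOpt (M.isMax s) (M.Q φ 0 s)
  rw [optQ_eq_playerOpt, ← ha, Q]
  simpa using (M.r_mem s a).1

theorem pessimistic_singleton_zero : M.Pessimistic φ {0} := by
  refine ⟨by simp, fun w hw s a => ?_⟩
  rw [Finset.mem_singleton] at hw
  subst hw
  have h : 0 ≤ M.expect s a (M.V φ {0}) :=
    integral_nonneg fun s => V_nonneg (by simp) s
  simpa [Q, backup] using mul_nonneg M.γ_nonneg h

theorem Pessimistic.V_le_bellman (h : M.Pessimistic φ θ) (s : S) :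
    M.V φ θ s ≤ M.bellman (M.V φ θ) s := by
  obtain ⟨w, hw, e⟩ := M.exists_optQ_eq_V φ ⟨0, h.1⟩ s
  rw [← e]
  exact playerOpt_mono fun a => h.2 w hw s a

theorem Pessimistic.V_le (h : M.Pessimistic φ θ) (hφ : ∀ s a, ∑ k, |φ s a k| ≤ 1) (hv : Bdd v)
    (hf : ∀ s, M.bellman v s = v s) (s : S) : M.V φ θ s ≤ v s :=
  M.le_of_le_bellman_of_bellman_le (M.bdd_V hφ ⟨0, h.1⟩) hv h.V_le_bellman (fun s => (hf s).le) s

/-- Playing greedily with respect to a pessimistic parameter guarantees its value function. -/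
theorem Pessimistic.V_le_value (h : M.Pessimistic φ θ) (hφ : ∀ s a, ∑ k, |φ s a k| ≤ 1)
    {π : Strategy A} (hπ : ∀ s, M.isMax s = true → M.IsGreedy φ θ s (π s)) (σ : Strategy A) (s : S) :
    M.V φ θ s ≤ M.value (M.pair π σ) s := by
  refine le_value (M.bdd_V hφ ⟨0, h.1⟩) (fun t => ?_) s
  cases ht : M.isMax t
  · exact (h.V_le_bellman t).trans (bellman_le_backup ht _)
  · obtain ⟨w, hw, e1, e2⟩ := hπ t ht
    have := h.2 w hw t (π t)
    rw [e2, e1] at this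
    simpa [pair, ht] using this

theorem flip_pair (M : TBSG S A) (π σ : Strategy A) : M.flip.pair π σ = M.pair σ π := by
  funext s
  cases h : M.isMax s <;> simp [pair, flip, h]

theorem Embeds.flip (h : M.Embeds φ) : M.flip.Embeds φ := h

/-- Greedy play on both sides with respect to accurate pessimistic parameters is `ε`-optimal. -/
theorem isEpsOptimal_of_pessimistic {θ η : Finset (Fin K → ℝ)} (hφ : ∀ s a, ∑ k, |φ s a k| ≤ 1)
    (hv : Bdd v) (hf : ∀ s, M.bellman v s = v s) {ε : ℝ}
    (hθ : M.Pessimistic φ θ) (hη : M.flip.Pessimistic φ η)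
    (h1 : ∀ s, v s - M.V φ θ s ≤ ε)
    (h2 : ∀ s, (1 / (1 - M.γ) - v s) - M.flip.V φ η s ≤ ε) {π : Strategy A}
    (hπ : ∀ s, if M.isMax s then M.IsGreedy φ θ s (π s) else M.flip.IsGreedy φ η s (π s)) :
    M.IsEpsOptimal ε π := by
  refine ⟨v, isEquilibriumValue_of_bellman_eq hv hf, fun s => ⟨fun σ => ?_, fun σ => ?_⟩⟩
  · have h3 := hη.V_le_value hφ (π := π) (fun t ht => by
      have h4 := hπ t
      have h5 : M.isMax t = false := by simpa [TBSG.flip] using ht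
      simpa [h5] using h4) σ s
    rw [flip_value, flip_pair] at h3
    linarith [h2 s]
  · have h3 := hθ.V_le_value hφ (π := π) (fun t ht => by simpa [ht] using hπ t) σ s
    linarith [h1 s]

/-! ### One inner iteration -/

theorem expect_eq_sum_anchor (hM : M.Embeds φ) {𝒦 : Fin K → (s : S) × A s}
    (hu : IsUnit (anchorMatrix φ 𝒦)) {g : S → ℝ} (hg : Bdd g) (s : S) (a : A s) :
    M.expect s a g = ∑ k, φ s a k *
      (anchorMatrix φ 𝒦)⁻¹.mulVec (fun k => M.expect (𝒦 k).1 (𝒦 k).2 g) k := by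
  obtain ⟨ψ, hψ⟩ := hM
  have hdet := (Matrix.isUnit_iff_isUnit_det _).1 hu
  have h1 : ∀ x, (fun k => ψ k x) = (anchorMatrix φ 𝒦)⁻¹.mulVec
      (fun k => (M.P (𝒦 k).1 (𝒦 k).2 x).toReal) := by
    intro x
    have h2 : (fun k => (M.P (𝒦 k).1 (𝒦 k).2 x).toReal) =
        (anchorMatrix φ 𝒦).mulVec (fun k => ψ k x) := by
      funext k
      rw [hψ]
      rfl
    rw [h2, Matrix.mulVec_mulVec, Matrix.nonsing_inv_mul _ hdet, Matrix.one_mulVec]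
  have hE : ∀ s a, HasSum (fun x => (M.P s a x).toReal * g x) (M.expect s a g) := by
    intro s a
    have hi := hg.integrable (M.P s a).toMeasure
    rw [expect, PMF.integral_eq_tsum _ _ hi]
    refine Summable.hasSum ?_
    obtain ⟨C, hC⟩ := hg
    refine Summable.of_norm_bounded (g := fun x => (M.P s a x).toReal * C)
      ((ENNReal.summable_toReal (M.P s a).tsum_coe_ne_top).mul_right C) fun x => ?_
    rw [norm_mul, Real.norm_of_nonneg ENNReal.toReal_nonneg]
    exact mul_le_mul_of_nonneg_left (hC x) ENNReal.toReal_nonneg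
  refine (hE s a).unique ?_
  have h3 : HasSum (fun x => ∑ k, φ s a k * ∑ l, (anchorMatrix φ 𝒦)⁻¹ k l *
      ((M.P (𝒦 l).1 (𝒦 l).2 x).toReal * g x))
      (∑ k, φ s a k * ∑ l, (anchorMatrix φ 𝒦)⁻¹ k l * M.expect (𝒦 l).1 (𝒦 l).2 g) :=
    hasSum_sum fun k _ => (hasSum_sum fun l _ => (hE _ _).mul_left _).mul_left _
  have h5 : (fun x => (M.P s a x).toReal * g x) = fun x => ∑ k, φ s a k *
      ∑ l, (anchorMatrix φ 𝒦)⁻¹ k l * ((M.P (𝒦 l).1 (𝒦 l).2 x).toReal * g x) := by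
    funext x
    rw [hψ, Finset.sum_mul]
    refine Finset.sum_congr rfl fun k _ => ?_
    have h4 : ψ k x = (anchorMatrix φ 𝒦)⁻¹.mulVec
        (fun k => (M.P (𝒦 k).1 (𝒦 k).2 x).toReal) k := congrFun (h1 x) k
    rw [h4, Matrix.mulVec, dotProduct, mul_assoc, Finset.sum_mul]
    simp only [mul_assoc]
  rw [h5]
  exact h3

variable {𝒦 : Fin K → (s : S) × A s} {w : Fin K → ℝ} {e : ℝ}

/-- The new vector underestimates the regression target, by at most `2 e` in each coordinate. -/
def Underestimates (M : TBSG S A) (φ : Features A K) (𝒦 : Fin K → (s : S) × A s) (g : S → ℝ)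
    (e : ℝ) (w : Fin K → ℝ) : Prop :=
  ∀ k, w k ≤ (anchorMatrix φ 𝒦)⁻¹.mulVec (fun k => M.expect (𝒦 k).1 (𝒦 k).2 g) k ∧
    (anchorMatrix φ 𝒦)⁻¹.mulVec (fun k => M.expect (𝒦 k).1 (𝒦 k).2 g) k ≤ w k + 2 * e

theorem Underestimates.Q_le (hw : M.Underestimates φ 𝒦 v e w) (hM : M.Embeds φ)
    (hu : IsUnit (anchorMatrix φ 𝒦)) (h0 : ∀ s a k, 0 ≤ φ s a k) (hv : Bdd v) (s : S) (a : A s) :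
    M.Q φ w s a ≤ M.backup v s a := by
  rw [Q, backup, expect_eq_sum_anchor hM hu hv]
  gcongr with k
  · exact M.γ_nonneg
  · exact h0 s a k
  · exact (hw k).1

theorem Underestimates.backup_le (hw : M.Underestimates φ 𝒦 v e w) (hM : M.Embeds φ)
    (hu : IsUnit (anchorMatrix φ 𝒦)) (h0 : ∀ s a k, 0 ≤ φ s a k)
    (hφ : ∀ s a, ∑ k, |φ s a k| ≤ 1) (he : 0 ≤ e) (hv : Bdd v) (s : S) (a : A s) :
    M.backup v s a ≤ M.Q φ w s a + 2 * e := by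
  have h1 : M.expect s a v ≤ ∑ k, φ s a k * w k + 2 * e := by
    rw [expect_eq_sum_anchor hM hu hv]
    calc _ ≤ ∑ k, φ s a k * (w k + 2 * e) := by
          gcongr with k
          · exact h0 s a k
          · exact (hw k).2
      _ = ∑ k, φ s a k * w k + (∑ k, |φ s a k|) * (2 * e) := by
          simp only [mul_add, Finset.sum_add_distrib, Finset.sum_mul, abs_of_nonneg (h0 s a _)]
      _ ≤ _ := by
          have : (∑ k, |φ s a k|) * (2 * e) ≤ 2 * e :=
            mul_le_of_le_one_left (by linarith) (hφ s a)
          linarith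
  have h2 := mul_le_mul_of_nonneg_left h1 M.γ_nonneg
  have h3 : M.γ * (2 * e) ≤ 2 * e := mul_le_of_le_one_left (by linarith) M.γ_lt_one.le
  rw [backup, Q]
  linarith

theorem Pessimistic.union (h : M.Pessimistic φ θ) (hw : M.Underestimates φ 𝒦 (M.V φ θ) e w)
    (hM : M.Embeds φ) (hu : IsUnit (anchorMatrix φ 𝒦)) (h0 : ∀ s a k, 0 ≤ φ s a k)
    (hφ : ∀ s a, ∑ k, |φ s a k| ≤ 1) : M.Pessimistic φ (θ ∪ {w}) := by
  have hB := M.bdd_V hφ ⟨0, h.1⟩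
  have hB' := M.bdd_V hφ (θ := θ ∪ {w}) ⟨0, Finset.mem_union_left _ h.1⟩
  have hm := M.V_mono (φ := φ) ⟨0, h.1⟩ (Finset.subset_union_left (s₁ := θ) (s₂ := {w}))
  refine ⟨Finset.mem_union_left _ h.1, fun u hu' s a => ?_⟩
  refine le_trans ?_ (M.backup_mono hB hB' hm s a)
  rcases Finset.mem_union.1 hu' with h' | h'
  · exact h.2 u h' s a
  · rw [Finset.mem_singleton.1 h']
    exact hw.Q_le hM hu h0 hB s a

theorem Underestimates.bellman_le (hw : M.Underestimates φ 𝒦 (M.V φ θ) e w) (h : 0 ∈ θ)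
    (hM : M.Embeds φ) (hu : IsUnit (anchorMatrix φ 𝒦)) (h0 : ∀ s a k, 0 ≤ φ s a k)
    (hφ : ∀ s a, ∑ k, |φ s a k| ≤ 1) (he : 0 ≤ e) (s : S) :
    M.bellman (M.V φ θ) s ≤ M.V φ (θ ∪ {w}) s + 2 * e := by
  have h1 : w ∈ θ ∪ {w} := by simp
  have h2 : M.bellman (M.V φ θ) s ≤ M.optQ φ w s + 2 * e :=
    playerOpt_le_add fun a => hw.backup_le hM hu h0 hφ he (M.bdd_V hφ ⟨0, h⟩) s a
  linarith [M.optQ_le_V (φ := φ) h1 s]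

end Pessimistic

end

section

variable {S : Type*} {A : S → Type*}

/-! ### The algorithm on accurate samples -/

/-- Truncation of `y` to `[0, b]`. -/
def clip (b y : ℝ) : ℝ := max 0 (min y b)

theorem clip_mem_Icc {b : ℝ} (hb : 0 ≤ b) (y : ℝ) : clip b y ∈ Set.Icc 0 b :=
  ⟨le_max_left _ _, max_le hb (min_le_right _ _)⟩

theorem clip_of_mem {b y : ℝ} (h0 : 0 ≤ y) (h1 : y ≤ b) : clip b y = y := by
  rw [clip, min_eq_left h1, max_eq_right h0]

section Algorithm

variable {K : ℕ} (M : TBSG S A) (φ : Features A K) (𝒦 : Fin K → (s : S) × A s) (p : RunParams)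

/-- The guaranteed gap to the equilibrium value at the beginning of the `i`-th outer iteration. -/
def gap (M : TBSG S A) (i : ℕ) : ℝ := 2⁻¹ ^ i / (1 - M.γ)

/-- Sizes of the batches of an outer iteration: the reference batch is indexed by `none`. -/
def batchSize : Option (Fin p.R) → ℕ
  | none => p.m
  | some _ => p.m₁

/-- Labels of the samples of a batch. -/
def batchLabel : (o : Option (Fin p.R)) → Fin (batchSize p o) → LocalDraw p
  | none, l => .inl l
  | some j, l => .inr (j, l)

/-- Upper bound for the function averaged over a batch. -/
def batchBound (i : ℕ) : Option (Fin p.R) → ℝ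
  | none => M.gap 0
  | some _ => M.gap i

/-- The function averaged over a batch, truncated to the range it has on accurate samples. -/
def batchTarget (x : RunDraw K p → S) (i : Fin (p.R' + 1)) : Option (Fin p.R) → S → ℝ
  | none => fun s => clip (M.gap 0) (M.V φ (M.outerParam φ 𝒦 p x i.castSucc) s)
  | some j => fun s => clip (M.gap i)
      (M.V φ (M.innerParam φ 𝒦 p (p.shift i) (M.outerParam φ 𝒦 p x i.castSucc)
        (fun k d => x (i, k, d)) j.castSucc) s - M.V φ (M.outerParam φ 𝒦 p x i.castSucc) s)

theorem gap_pos (i : ℕ) : 0 < M.gap i := div_pos (by positivity) M.one_sub_γ_pos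

theorem batchBound_pos (i : ℕ) (o : Option (Fin p.R)) : 0 < M.batchBound p i o := by
  cases o <;> exact M.gap_pos _

theorem batchTarget_mem_Icc (x : RunDraw K p → S) (i : Fin (p.R' + 1)) (o : Option (Fin p.R))
    (s : S) : M.batchTarget φ 𝒦 p x i o s ∈ Set.Icc 0 (M.batchBound p i o) := by
  cases o <;> exact clip_mem_Icc (M.gap_pos _).le _

variable {M φ 𝒦 p} in
theorem innerParam_zero (e : ℝ) (θ₀ : Finset (Fin K → ℝ)) (y : Fin K → LocalDraw p → S) :
    M.innerParam φ 𝒦 p e θ₀ y 0 = θ₀ := rfl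

variable {M φ 𝒦 p} in
theorem innerParam_succ (e : ℝ) (θ₀ : Finset (Fin K → ℝ)) (y : Fin K → LocalDraw p → S)
    (j : Fin p.R) : M.innerParam φ 𝒦 p e θ₀ y j.succ = M.innerParam φ 𝒦 p e θ₀ y j.castSucc ∪
      {M.newVector φ 𝒦 p e θ₀ y j (M.innerParam φ 𝒦 p e θ₀ y j.castSucc)} := rfl

variable {M φ 𝒦 p} in
theorem outerParam_zero (x : RunDraw K p → S) : M.outerParam φ 𝒦 p x 0 = {0} := rfl

variable {M φ 𝒦 p} in
theorem outerParam_succ (x : RunDraw K p → S) (i : Fin (p.R' + 1)) :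
    M.outerParam φ 𝒦 p x i.succ = M.innerParam φ 𝒦 p (p.shift i)
      (M.outerParam φ 𝒦 p x i.castSucc) (fun k d => x (i, k, d)) (Fin.last p.R) := rfl

theorem newVector_apply (e : ℝ) (θ₀ : Finset (Fin K → ℝ)) (y : Fin K → LocalDraw p → S)
    (j : Fin p.R) (θ : Finset (Fin K → ℝ)) (k : Fin K) : M.newVector φ 𝒦 p e θ₀ y j θ k =
      (anchorMatrix φ 𝒦)⁻¹.mulVec (M.vrEstimate φ p θ₀ y j θ) k - e := rfl

theorem refEstimate_apply (θ₀ : Finset (Fin K → ℝ)) (y : Fin K → LocalDraw p → S) (k : Fin K) :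
    M.refEstimate φ p θ₀ y k = 1 / (p.m : ℝ) * ∑ l, M.V φ θ₀ (y k (.inl l)) := rfl

theorem vrEstimate_apply (θ₀ : Finset (Fin K → ℝ)) (y : Fin K → LocalDraw p → S) (j : Fin p.R)
    (θ : Finset (Fin K → ℝ)) (k : Fin K) : M.vrEstimate φ p θ₀ y j θ k =
      1 / (p.m₁ : ℝ) * ∑ l, (M.V φ θ (y k (.inr (j, l))) - M.V φ θ₀ (y k (.inr (j, l)))) +
        M.refEstimate φ p θ₀ y k := rfl

variable [Countable S] [MeasurableSpace S] [MeasurableSingletonClass S]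

/-- All batches of the `i`-th outer iteration and the anchor `k` estimate accurately. -/
def Accurate (ℓ : ℝ) (x : RunDraw K p → S) (i : Fin (p.R' + 1)) (k : Fin K)
    (o : Option (Fin p.R)) : Prop :=
  |1 / (batchSize p o : ℝ) * ∑ l, M.batchTarget φ 𝒦 p x i o (x (i, k, batchLabel p o l)) -
    M.expect (𝒦 k).1 (𝒦 k).2 (M.batchTarget φ 𝒦 p x i o)| ≤
      M.batchBound p i o * √(ℓ / batchSize p o)

variable [∀ s, Finite (A s)] [∀ s, Nonempty (A s)] {M φ 𝒦 p} {v : S → ℝ}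

theorem underestimates_sub {g : S → ℝ} {L e t : ℝ}
    (hL : ∀ k, ∑ l, |(anchorMatrix φ 𝒦)⁻¹ k l| ≤ L) (ht : 0 ≤ t) (he : L * t ≤ e)
    {y : Fin K → ℝ} (hy : ∀ k, |y k - M.expect (𝒦 k).1 (𝒦 k).2 g| ≤ t) :
    M.Underestimates φ 𝒦 g e fun k => (anchorMatrix φ 𝒦)⁻¹.mulVec y k - e := by
  intro k
  have h : |(anchorMatrix φ 𝒦)⁻¹.mulVec y k -
      (anchorMatrix φ 𝒦)⁻¹.mulVec (fun k => M.expect (𝒦 k).1 (𝒦 k).2 g) k| ≤ e := by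
    have h1 : (anchorMatrix φ 𝒦)⁻¹.mulVec y k -
        (anchorMatrix φ 𝒦)⁻¹.mulVec (fun k => M.expect (𝒦 k).1 (𝒦 k).2 g) k =
        ∑ l, (anchorMatrix φ 𝒦)⁻¹ k l * (y l - M.expect (𝒦 l).1 (𝒦 l).2 g) := by
      simp only [Matrix.mulVec, dotProduct, mul_sub, Finset.sum_sub_distrib]
    rw [h1]
    calc _ ≤ ∑ l, |(anchorMatrix φ 𝒦)⁻¹ k l * (y l - M.expect (𝒦 l).1 (𝒦 l).2 g)| :=
          Finset.abs_sum_le_sum_abs _ _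
      _ ≤ ∑ l, |(anchorMatrix φ 𝒦)⁻¹ k l| * t := by
          refine Finset.sum_le_sum fun l _ => ?_
          rw [abs_mul]
          exact mul_le_mul_of_nonneg_left (hy l) (abs_nonneg _)
      _ ≤ L * t := by
          rw [← Finset.sum_mul]
          exact mul_le_mul_of_nonneg_right (hL k) ht
      _ ≤ e := he
  rw [abs_le] at h
  constructor <;> linarith [h.1, h.2]

/-- Progress of the inner iterations, if their estimates are accurate. -/
theorem innerParam_spec {L e t t₁ : ℝ} {i : Fin (p.R' + 1)} {x : RunDraw K p → S}
    (hM : M.Embeds φ) (h0 : ∀ s a k, 0 ≤ φ s a k) (hA : AnchorBound φ 𝒦 L)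
    (hv : Bdd v) (hf : ∀ s, M.bellman v s = v s)
    (hθ : M.Pessimistic φ (M.outerParam φ 𝒦 p x i.castSucc))
    (hgap : ∀ s, v s - M.V φ (M.outerParam φ 𝒦 p x i.castSucc) s ≤ M.gap i)
    (ht : 0 ≤ t) (ht₁ : 0 ≤ t₁) (he : L * (t₁ + t) ≤ e)
    (hacc : ∀ k, |1 / (p.m : ℝ) *
        ∑ l, M.batchTarget φ 𝒦 p x i none (x (i, k, .inl l)) -
      M.expect (𝒦 k).1 (𝒦 k).2 (M.batchTarget φ 𝒦 p x i none)| ≤ t)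
    (hacc₁ : ∀ k j, |1 / (p.m₁ : ℝ) *
        ∑ l, M.batchTarget φ 𝒦 p x i (some j) (x (i, k, .inr (j, l))) -
      M.expect (𝒦 k).1 (𝒦 k).2 (M.batchTarget φ 𝒦 p x i (some j))| ≤ t₁)
    (j : Fin (p.R + 1)) :
    let θ := M.innerParam φ 𝒦 p (p.shift i) (M.outerParam φ 𝒦 p x i.castSucc)
      (fun k d => x (i, k, d)) j
    p.shift i = e → M.Pessimistic φ θ ∧ M.outerParam φ 𝒦 p x i.castSucc ⊆ θ ∧
      ∀ s, v s - M.V φ θ s ≤ M.γ ^ (j : ℕ) * M.gap i + 2 * e / (1 - M.γ) := by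
  intro θ hse
  obtain ⟨hφ, hL0, hu, hL⟩ := hA
  have he0 : 0 ≤ e := le_trans (mul_nonneg hL0.le (add_nonneg ht₁ ht)) he
  have hγ := M.one_sub_γ_pos
  simp only [θ]
  clear θ
  induction j using Fin.induction with
  | zero =>
    rw [innerParam_zero]
    refine ⟨hθ, subset_rfl, fun s => (hgap s).trans ?_⟩
    simp only [Fin.val_zero, pow_zero, one_mul, le_add_iff_nonneg_right]
    positivity
  | succ j ih =>
    rw [innerParam_succ]
    have hj := fun k => hacc₁ k j
    simp only [batchTarget] at hacc hj
    generalize hθj : M.innerParam φ 𝒦 p (p.shift i) (M.outerParam φ 𝒦 p x i.castSucc)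
      (fun k d => x (i, k, d)) j.castSucc = θj at ih hj ⊢
    generalize M.outerParam φ 𝒦 p x i.castSucc = θ₀ at *
    obtain ⟨ih1, ih2, ih3⟩ := ih
    rw [hse]
    have hB := M.bdd_V hφ ⟨0, ih1.1⟩
    have hB₀ := M.bdd_V hφ ⟨0, hθ.1⟩
    have hle := ih1.V_le hφ hv hf
    have hle₀ := hθ.V_le hφ hv hf
    have hvB := M.mem_Icc_of_bellman_eq hv hf
    have hc : ∀ s, clip (M.gap 0) (M.V φ θ₀ s) = M.V φ θ₀ s := fun s =>
      clip_of_mem (V_nonneg hθ.1 s) ((hle₀ s).trans (by simpa [gap] using (hvB s).2))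
    have hc₁ : ∀ s, clip (M.gap i) (M.V φ θj s - M.V φ θ₀ s) = M.V φ θj s - M.V φ θ₀ s := fun s =>
      clip_of_mem (by linarith [M.V_mono (φ := φ) ⟨0, hθ.1⟩ ih2 s]) (by linarith [hgap s, hle s])
    simp only [hc] at hacc
    simp only [hc₁] at hj
    have hU : M.Underestimates φ 𝒦 (M.V φ θj) e
        (M.newVector φ 𝒦 p e θ₀ (fun k d => x (i, k, d)) j θj) := by
      refine underestimates_sub hL (add_nonneg ht₁ ht) he fun k => ?_
      have h1 := hj k
      rw [M.expect_sub hB hB₀] at h1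
      have h2 := abs_add_le _ _ |>.trans (add_le_add h1 (hacc k))
      refine (le_of_eq (congrArg abs ?_)).trans h2
      change _ = _ - (_ - _) + (_ - M.expect (𝒦 k).1 (𝒦 k).2 (M.V φ θ₀))
      rw [vrEstimate_apply, refEstimate_apply]
      ring
    refine ⟨ih1.union hU hM hu h0 hφ, ih2.trans Finset.subset_union_left, fun s => ?_⟩
    have h1 := hU.bellman_le ih1.1 hM hu h0 hφ he0 s
    have h2 := M.bellman_le_add hv hB (c := M.γ ^ (j : ℕ) * M.gap i + 2 * e / (1 - M.γ))
      (fun s => by have := ih3 s; rw [Fin.val_castSucc] at this; linarith) s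
    rw [hf] at h2
    have h3 : 2 * e / (1 - M.γ) = M.γ * (2 * e / (1 - M.γ)) + 2 * e := by field_simp; ring
    rw [Fin.val_succ, pow_succ]
    linarith

/-- Quality of the output of the one-sided algorithm, if all its estimates are accurate. -/
theorem oneSided_spec {L ℓ : ℝ} {x : RunDraw K p → S}
    (hM : M.Embeds φ) (h0 : ∀ s a k, 0 ≤ φ s a k) (hA : AnchorBound φ 𝒦 L)
    (hv : Bdd v) (hf : ∀ s, M.bellman v s = v s)
    (hshift : ∀ i, L * (M.gap i * √(ℓ / p.m₁) + M.gap 0 * √(ℓ / p.m)) ≤ p.shift i)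
    (hsmall : ∀ i ≤ p.R', 2 * p.shift i / (1 - M.γ) ≤ M.gap i / 4)
    (hR : M.γ ^ p.R ≤ 1 / 4)
    (hacc : ∀ i k o, M.Accurate φ 𝒦 p ℓ x i k o) :
    M.Pessimistic φ (M.oneSided φ 𝒦 p x) ∧
      ∀ s, v s - M.V φ (M.oneSided φ 𝒦 p x) s ≤ M.gap (p.R' + 1) := by
  have key : ∀ i : Fin (p.R' + 1 + 1), M.Pessimistic φ (M.outerParam φ 𝒦 p x i) ∧
      ∀ s, v s - M.V φ (M.outerParam φ 𝒦 p x i) s ≤ M.gap i := by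
    intro i
    induction i using Fin.induction with
    | zero =>
      rw [outerParam_zero]
      refine ⟨pessimistic_singleton_zero, fun s => ?_⟩
      have h1 := (M.mem_Icc_of_bellman_eq hv hf s).2
      have h2 : 0 ≤ M.V φ {0} s := V_nonneg (by simp) s
      have h3 : M.gap ((0 : Fin (p.R' + 1 + 1)) : ℕ) = 1 / (1 - M.γ) := by simp [gap]
      linarith
    | succ i ih =>
      have h := innerParam_spec (t := M.gap 0 * √(ℓ / p.m)) (t₁ := M.gap i * √(ℓ / p.m₁))
        hM h0 hA hv hf ih.1 ih.2 (mul_nonneg (M.gap_pos _).le (Real.sqrt_nonneg _))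
        (mul_nonneg (M.gap_pos _).le (Real.sqrt_nonneg _)) (hshift i)
        (fun k => hacc i k none) (fun k j => hacc i k (some j)) (Fin.last p.R) rfl
      rw [outerParam_succ]
      refine ⟨h.1, fun s => (h.2.2 s).trans ?_⟩
      have h1 := mul_le_mul_of_nonneg_right hR (M.gap_pos i).le
      have h2 := hsmall i (Nat.lt_succ_iff.1 i.2)
      have h3 : M.gap ((i.succ : Fin _) : ℕ) = M.gap i / 2 := by
        rw [Fin.val_succ, gap, gap, pow_succ]; ring
      rw [h3, Fin.val_last]
      linarith
  exact key (Fin.last _)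

end Algorithm

end

/-! ### Hoeffding's inequality for adaptively chosen functions -/

theorem measureReal_sum_sub_integral_ge_le {T ι : Type*} [MeasurableSpace T] [Countable T]
    [MeasurableSingletonClass T] [Fintype ι] {ρ : Measure T} [IsProbabilityMeasure ρ] {f : T → ℝ}
    {a b : ℝ} (hf : ∀ s, f s ∈ Set.Icc a b) {r : ℝ} (hr : 0 ≤ r) :
    (Measure.pi fun _ : ι => ρ).real {z | r ≤ ∑ i, (f (z i) - ∫ s, f s ∂ρ)} ≤
      Real.exp (-(2 * r ^ 2) / (Fintype.card ι * (b - a) ^ 2)) := by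
  have hm : Measurable f := measurable_of_countable f
  have h := HasSubgaussianMGF.measure_sum_ge_le_of_iIndepFun (μ := Measure.pi fun _ : ι => ρ)
    (iIndepFun_pi (X := fun (_ : ι) s => f s - ∫ s, f s ∂ρ)
      fun i => (hm.sub_const _).aemeasurable) (c := fun _ => (‖b - a‖₊ / 2) ^ 2)
    (s := Finset.univ) (fun i _ => by
      have h1 := hasSubgaussianMGF_of_mem_Icc (μ := ρ) hm.aemeasurable
        (Filter.Eventually.of_forall hf)
      have h2 := measurePreserving_eval (fun _ : ι => ρ) i
      refine HasSubgaussianMGF.of_map (X := fun s => f s - ∫ s, f s ∂ρ) (Y := Function.eval i)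
        h2.measurable.aemeasurable ?_
      rw [h2.map_eq]
      exact h1) hr
  refine h.trans (le_of_eq ?_)
  congr 1
  simp only [Finset.sum_const, Finset.card_univ, nsmul_eq_mul]
  push_cast
  rw [Real.norm_eq_abs, div_pow, sq_abs]
  rw [show 2 * ((Fintype.card ι : ℝ) * ((b - a) ^ 2 / 2 ^ 2)) =
    (Fintype.card ι * (b - a) ^ 2) / 2 by ring, div_div_eq_mul_div]
  ring

theorem measure_abs_mean_sub_integral_gt_le {T ι : Type*} [MeasurableSpace T] [Countable T]
    [MeasurableSingletonClass T] [Fintype ι] {ρ : Measure T} [IsProbabilityMeasure ρ] {f : T → ℝ}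
    {b ℓ : ℝ} (hb : 0 < b) (hf : ∀ s, f s ∈ Set.Icc 0 b) (hℓ : 0 ≤ ℓ) (hι : 0 < Fintype.card ι) :
    (Measure.pi fun _ : ι => ρ) {z | b * √(ℓ / Fintype.card ι) <
        |1 / (Fintype.card ι : ℝ) * ∑ i, f (z i) - ∫ s, f s ∂ρ|} ≤
      ENNReal.ofReal (2 * Real.exp (-(2 * ℓ))) := by
  set n : ℝ := (Fintype.card ι : ℝ) with hn
  have hn0 : 0 < n := by rw [hn]; exact_mod_cast hι
  set r : ℝ := n * (b * √(ℓ / n)) with hr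
  have hr0 : 0 ≤ r := by positivity
  have hexp : -(2 * r ^ 2) / (n * b ^ 2) = -(2 * ℓ) := by
    rw [hr, mul_pow, mul_pow, Real.sq_sqrt (by positivity)]
    field_simp
  have h1 := measureReal_sum_sub_integral_ge_le (ι := ι) (ρ := ρ) hf hr0
  have h2 := measureReal_sum_sub_integral_ge_le (ι := ι) (ρ := ρ) (f := fun s => -f s)
    (a := -b) (b := 0) (fun s => ⟨neg_le_neg (hf s).2, neg_nonpos.2 (hf s).1⟩) hr0
  rw [← hn, sub_zero, hexp] at h1
  rw [← hn, zero_sub, neg_neg, hexp] at h2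
  have hmean : ∀ z : ι → T, ∑ i, (f (z i) - ∫ s, f s ∂ρ) =
      n * (1 / n * ∑ i, f (z i) - ∫ s, f s ∂ρ) := by
    intro z
    rw [Finset.sum_sub_distrib, Finset.sum_const, Finset.card_univ, nsmul_eq_mul, ← hn]
    field_simp
  refine le_trans (measure_mono (t := {z | r ≤ ∑ i, (f (z i) - ∫ s, f s ∂ρ)} ∪
    {z | r ≤ ∑ i, (-f (z i) - ∫ s, -f s ∂ρ)}) ?_) ?_
  · intro z hz
    rw [Set.mem_ofPred_eq, lt_abs] at hz
    have h3 : ∑ i, (-f (z i) - ∫ s, -f s ∂ρ) = -∑ i, (f (z i) - ∫ s, f s ∂ρ) := by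
      rw [integral_neg, ← Finset.sum_neg_distrib]
      exact Finset.sum_congr rfl fun i _ => by ring
    rcases hz with hz | hz
    · left
      rw [Set.mem_ofPred_eq, hmean]
      exact mul_le_mul_of_nonneg_left hz.le hn0.le
    · right
      rw [Set.mem_ofPred_eq, h3, hmean, ← mul_neg]
      exact mul_le_mul_of_nonneg_left hz.le hn0.le
  · refine (measure_union_le _ _).trans ?_
    rw [two_mul, ENNReal.ofReal_add (Real.exp_pos _).le (Real.exp_pos _).le]
    rw [measureReal_def] at h1 h2
    exact add_le_add (ENNReal.le_ofReal_iff_toReal_le (measure_ne_top _ _) (Real.exp_pos _).le |>.2 h1)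
      (ENNReal.le_ofReal_iff_toReal_le (measure_ne_top _ _) (Real.exp_pos _).le |>.2 h2)

/-- Hoeffding's inequality for the average of a function over a batch `J` of independent samples,
where the function may depend on the samples outside the batch. -/
theorem measure_adaptive_mean_gt_le {T ι : Type*} [MeasurableSpace T] [Countable T]
    [MeasurableSingletonClass T] [Fintype ι] (ν : ι → Measure T) [∀ i, IsProbabilityMeasure (ν i)]
    {n : ℕ} (hn : 0 < n) {J : Fin n → ι} (hJ : Function.Injective J) {ρ : Measure T}
    (hν : ∀ l, ν (J l) = ρ) {F : (ι → T) → T → ℝ} {b ℓ : ℝ} (hb : 0 < b) (hℓ : 0 ≤ ℓ)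
    (hF : ∀ x s, F x s ∈ Set.Icc 0 b)
    (hdep : ∀ x x', (∀ i, i ∉ Set.range J → x i = x' i) → F x = F x') :
    Measure.pi ν {x | b * √(ℓ / n) < |1 / (n : ℝ) * ∑ l, F x (x (J l)) - ∫ s, F x s ∂ρ|} ≤
      ENNReal.ofReal (2 * Real.exp (-(2 * ℓ))) := by
  classical
  have hρ : IsProbabilityMeasure ρ := by rw [← hν ⟨0, hn⟩]; infer_instance
  rcases isEmpty_or_nonempty (ι → T) with he | ⟨⟨x₀⟩⟩
  · rw [Set.eq_empty_of_isEmpty {x | _}]; simp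
  obtain ⟨P, hP⟩ : ∃ P : ι → Prop, ∀ i, i ∈ Set.range J ↔ P i := ⟨_, fun _ => Iff.rfl⟩
  let e := MeasurableEquiv.piEquivPiSubtypeProd (fun _ : ι => T) P
  have hmp := measurePreserving_piEquivPiSubtypeProd ν P
  set E := {x | b * √(ℓ / n) < |1 / (n : ℝ) * ∑ l, F x (x (J l)) - ∫ s, F x s ∂ρ|}
  have hE : Measure.pi ν E = ((Measure.pi fun i : Subtype P => ν i).prod
      (Measure.pi fun i : {i // ¬ P i} => ν i)) (e.symm ⁻¹' E) := by
    refine Eq.trans (congrArg _ ?_) (hmp.measure_preimage_equiv (e.symm ⁻¹' E))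
    ext x
    change _ ↔ e.symm (e x) ∈ E
    rw [e.symm_apply_apply]
  rw [hE, Measure.prod_apply_symm (Set.to_countable _).measurableSet]
  have hνP : (fun i : Subtype P => ν i) = fun _ => ρ := by
    funext i
    obtain ⟨l, hl⟩ := (hP i).2 i.2
    rw [← hl, hν]
  let eJ : Fin n ≃ Subtype P := (Equiv.ofInjective J hJ).trans (Equiv.subtypeEquivRight hP)
  have hcard : Fintype.card (Subtype P) = n := by
    rw [← Fintype.card_congr eJ, Fintype.card_fin]
  have hslice : ∀ y : {i // ¬ P i} → T, (Measure.pi fun i : Subtype P => ν i)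
      ((fun z => (z, y)) ⁻¹' (e.symm ⁻¹' E)) ≤ ENNReal.ofReal (2 * Real.exp (-(2 * ℓ))) := by
    intro y
    rw [hνP]
    have h := measure_abs_mean_sub_integral_gt_le (ι := Subtype P) (ρ := ρ) hb
      (hF (e.symm (fun i => x₀ i, y))) hℓ (by rw [hcard]; exact hn)
    refine le_trans (measure_mono fun z hz => ?_) h
    change b * √(ℓ / n) < |1 / (n : ℝ) * ∑ l, F (e.symm (z, y)) (e.symm (z, y) (J l)) -
      ∫ s, F (e.symm (z, y)) s ∂ρ| at hz
    have h1 : F (e.symm (z, y)) = F (e.symm (fun i => x₀ i, y)) := by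
      refine hdep _ _ fun i hi => ?_
      have hi' : ¬ P i := fun h => hi ((hP i).2 h)
      change (Equiv.piEquivPiSubtypeProd P fun _ => T).symm (z, y) i =
        (Equiv.piEquivPiSubtypeProd P fun _ => T).symm (fun i => x₀ i, y) i
      simp [Equiv.piEquivPiSubtypeProd, hi']
    have h2 : ∀ l, e.symm (z, y) (J l) = z (eJ l) := by
      intro l
      have hl : P (J l) := (hP _).1 ⟨l, rfl⟩
      change (Equiv.piEquivPiSubtypeProd P fun _ => T).symm (z, y) (J l) = _
      simp only [Equiv.piEquivPiSubtypeProd, Equiv.coe_fn_symm_mk, hl, dif_pos]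
      rfl
    rw [h1] at hz
    simp only [h2] at hz
    rw [Equiv.sum_comp eJ fun i => F (e.symm (fun i => x₀ i, y)) (z i)] at hz
    rw [Set.mem_ofPred_eq, hcard]
    exact hz
  calc _ ≤ ∫⁻ _, ENNReal.ofReal (2 * Real.exp (-(2 * ℓ)))
        ∂(Measure.pi fun i : {i // ¬ P i} => ν i) := lintegral_mono hslice
    _ = _ := by simp

/-! ### The samples are accurate with high probability -/

section Accuracy

variable {S : Type*} {A : S → Type*} {K : ℕ} {M : TBSG S A} {φ : Features A K}
  {𝒦 : Fin K → (s : S) × A s} {p : RunParams}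

theorem innerParam_congr {e : ℝ} {θ₀ : Finset (Fin K → ℝ)} {y y' : Fin K → LocalDraw p → S}
    (j : Fin (p.R + 1)) (h : ∀ k l, y k (.inl l) = y' k (.inl l))
    (h₁ : ∀ k (j' : Fin p.R) l, (j' : ℕ) < j → y k (.inr (j', l)) = y' k (.inr (j', l))) :
    M.innerParam φ 𝒦 p e θ₀ y j = M.innerParam φ 𝒦 p e θ₀ y' j := by
  induction j using Fin.induction with
  | zero => rw [innerParam_zero, innerParam_zero]
  | succ j ih =>
    rw [innerParam_succ, innerParam_succ, ih fun k j' l hj' => h₁ k j' l (hj'.trans (by simp))]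
    have hr : M.refEstimate φ p θ₀ y = M.refEstimate φ p θ₀ y' := by
      funext k
      simp only [refEstimate_apply, h]
    have hv : ∀ θ, M.vrEstimate φ p θ₀ y j θ = M.vrEstimate φ p θ₀ y' j θ := by
      intro θ
      funext k
      rw [vrEstimate_apply, vrEstimate_apply, hr]
      congr 2
      refine Finset.sum_congr rfl fun l _ => ?_
      rw [h₁ k j l (by simp)]
    have hw : ∀ θ, M.newVector φ 𝒦 p e θ₀ y j θ = M.newVector φ 𝒦 p e θ₀ y' j θ := by
      intro θ
      funext k
      rw [newVector_apply, newVector_apply, hv]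
    rw [hw]

theorem outerParam_congr {x x' : RunDraw K p → S} (i : Fin (p.R' + 1 + 1))
    (h : ∀ (i' : Fin (p.R' + 1)) k d, (i' : ℕ) < i → x (i', k, d) = x' (i', k, d)) :
    M.outerParam φ 𝒦 p x i = M.outerParam φ 𝒦 p x' i := by
  induction i using Fin.induction with
  | zero => rw [outerParam_zero, outerParam_zero]
  | succ i ih =>
    rw [outerParam_succ, outerParam_succ, ih fun i' k d hi' => h i' k d (hi'.trans (by simp))]
    exact innerParam_congr _ (fun k l => h i k _ (by simp)) fun k j l _ => h i k _ (by simp)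

theorem batchTarget_congr {x x' : RunDraw K p → S} (i : Fin (p.R' + 1))
    (o : Option (Fin p.R))
    (h : ∀ (i' : Fin (p.R' + 1)) k d, (i' : ℕ) < i → x (i', k, d) = x' (i', k, d))
    (h' : ∀ j, o = some j → ∀ k l, x (i, k, .inl l) = x' (i, k, .inl l))
    (h₁ : ∀ j, o = some j → ∀ k (j' : Fin p.R) l, (j' : ℕ) < j →
      x (i, k, .inr (j', l)) = x' (i, k, .inr (j', l))) :
    M.batchTarget φ 𝒦 p x i o = M.batchTarget φ 𝒦 p x' i o := by
  have hO : M.outerParam φ 𝒦 p x i.castSucc = M.outerParam φ 𝒦 p x' i.castSucc :=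
    outerParam_congr _ h
  cases o with
  | none => simp only [batchTarget, hO]
  | some j =>
    simp only [batchTarget, hO]
    rw [innerParam_congr (y := fun k d => x (i, k, d)) (y' := fun k d => x' (i, k, d)) j.castSucc
      (h' j rfl) (h₁ j rfl)]

theorem batchLabel_injective (o : Option (Fin p.R)) : Function.Injective (batchLabel p o) := by
  cases o with
  | none => exact fun a b h => Sum.inl.inj h
  | some j => exact fun a b h => (Prod.mk.inj (Sum.inr.inj h)).2

variable [Countable S] [MeasurableSpace S] [MeasurableSingletonClass S]

/-- Each batch of each run is accurate up to probability `2 exp (-2 ℓ)`, for every game `N` with the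
transitions of `M`. -/
theorem measure_not_accurate_le (N : TBSG S A) (hN : N.P = M.P) (c : Fin 2) {ℓ : ℝ} (hℓ : 0 ≤ ℓ)
    (hm : 0 < p.m) (hm₁ : 0 < p.m₁) (i : Fin (p.R' + 1)) (k : Fin K) (o : Option (Fin p.R)) :
    M.sampleLaw 𝒦 p {x | ¬ N.Accurate φ 𝒦 p ℓ (fun q => x (c, q)) i k o} ≤
      ENNReal.ofReal (2 * Real.exp (-(2 * ℓ))) := by
  have hn : 0 < batchSize p o := by cases o <;> assumption
  have h := measure_adaptive_mean_gt_le
    (fun q : Draw K p => (M.P (𝒦 q.2.2.1).1 (𝒦 q.2.2.1).2).toMeasure) hn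
    (J := fun l => (c, i, k, batchLabel p o l))
    (fun a b hab => batchLabel_injective o (by simpa using hab))
    (ρ := (M.P (𝒦 k).1 (𝒦 k).2).toMeasure) (fun _ => rfl)
    (F := fun x => N.batchTarget φ 𝒦 p (fun q => x (c, q)) i o)
    (N.batchBound_pos p i o) hℓ (fun x => N.batchTarget_mem_Icc φ 𝒦 p _ i o) (by
      intro x x' hx
      refine batchTarget_congr i o (fun i' k' d hi' => hx _ ?_) (fun j hj k' l => hx _ ?_)
        (fun j hj k' j' l hj' => hx _ ?_)
      · rintro ⟨l, hl⟩
        simp only [Prod.mk.injEq, true_and] at hl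
        rw [hl.1] at hi'
        exact lt_irrefl _ hi'
      · subst hj
        rintro ⟨l, hl⟩
        simp [batchLabel] at hl
      · subst hj
        rintro ⟨l, hl⟩
        simp only [Prod.mk.injEq, true_and, batchLabel, Sum.inr.injEq] at hl
        have hl' := (Prod.mk.inj hl.2).1
        rw [hl'] at hj'
        exact lt_irrefl _ hj')
  simp only [Accurate, not_le, expect, hN]
  exact h

/-- Union bound over all batches of both runs. -/
theorem measure_exists_not_accurate_le (N : Fin 2 → TBSG S A) (hN : ∀ c, (N c).P = M.P) {ℓ : ℝ}
    (hℓ : 0 ≤ ℓ) (hm : 0 < p.m) (hm₁ : 0 < p.m₁) :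
    M.sampleLaw 𝒦 p {x | ∀ c i k o, (N c).Accurate φ 𝒦 p ℓ (fun q => x (c, q)) i k o}ᶜ ≤
      ENNReal.ofReal (2 * ((p.R' + 1) * K * (p.R + 1)) * (2 * Real.exp (-(2 * ℓ)))) := by
  let I := Fin 2 × Fin (p.R' + 1) × Fin K × Option (Fin p.R)
  have hsub : {x | ∀ c i k o, (N c).Accurate φ 𝒦 p ℓ (fun q => x (c, q)) i k o}ᶜ ⊆
      ⋃ q : I, {x : Draw K p → S |
        ¬ (N q.1).Accurate φ 𝒦 p ℓ (fun q' => x (q.1, q')) q.2.1 q.2.2.1 q.2.2.2} := by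
    intro x hx
    simp only [Set.mem_compl_iff, Set.mem_ofPred_eq, not_forall] at hx
    obtain ⟨c, i, k, o, h⟩ := hx
    exact Set.mem_iUnion.2 ⟨(c, i, k, o), h⟩
  refine (measure_mono hsub).trans ((measure_iUnion_le _).trans ?_)
  rw [tsum_fintype]
  refine (Finset.sum_le_sum fun q _ =>
    measure_not_accurate_le (N q.1) (hN _) q.1 hℓ hm hm₁ q.2.1 q.2.2.1 q.2.2.2).trans ?_
  rw [Finset.sum_const, Finset.card_univ,
    ENNReal.ofReal_mul (p := 2 * (((p.R' : ℝ) + 1) * K * (p.R + 1))) (by positivity), nsmul_eq_mul]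
  refine mul_le_mul' ?_ le_rfl
  simp only [I, Fintype.card_prod, Fintype.card_fin, Fintype.card_option]
  rw [← ENNReal.ofReal_natCast]
  refine le_of_eq ?_
  congr 1
  push_cast
  ring

end Accuracy

/-! ### The choice of the parameters -/

/-- Constants for which the parameters meet the accuracy requirements. -/
def explicitConsts : HiddenConsts where
  cR' := 1 / Real.log 2
  cR := 8
  cm := 1024
  cm₁ := 256
  cε₁ := 1
  cε₂ := 1

/-- The confidence exponent `ℓ` of the parameters `p`. -/
def RunParams.logTerm (p : RunParams) (K : ℕ) (δ : ℝ) : ℝ := Real.log (p.R' * p.R * K / δ)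

section Params

variable {γ L ε δ : ℝ} {K : ℕ}

theorem runParams_bounds (hγ0 : 0 ≤ γ) (hγ1 : γ < 1) (hε0 : 0 < ε) (hε1 : ε < 1) (hδ0 : 0 < δ)
    (hδ1 : δ < 1) (hK : 1 ≤ K) :
    let p := runParams explicitConsts γ K L ε δ
    1 ≤ p.R' ∧ (1 / (ε * (1 - γ)) ≤ 2 ^ p.R' ∧ (2 : ℝ) ^ p.R' ≤ 2 * (1 / (ε * (1 - γ)))) ∧
      (p.R' : ℝ) * Real.log 2 ≤ Real.log (1 / (ε * (1 - γ))) + Real.log 2 ∧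
      (8 * (p.R' / (1 - γ)) ≤ (p.R : ℝ) ∧ (p.R : ℝ) ≤ 9 * p.R' / (1 - γ)) ∧ 8 ≤ (p.R : ℝ) ∧
      8 ≤ p.R' * p.R * K / δ ∧ 0 < p.logTerm K δ := by
  intro p
  have hu : 0 < 1 - γ := by linarith
  set X := 1 / (ε * (1 - γ)) with hX
  have hX1 : 1 < X := by
    rw [hX, lt_div_iff₀ (by positivity)]
    nlinarith
  have hl2 : 0 < Real.log 2 := Real.log_pos (by norm_num)
  have hlX : 0 < Real.log X := Real.log_pos hX1
  have hR'def : p.R' = ⌈1 / Real.log 2 * Real.log X⌉₊ := rfl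
  have hRdef : p.R = ⌈8 * ((p.R' : ℝ) / (1 - γ))⌉₊ := rfl
  have h1 : 1 ≤ p.R' := by
    rw [hR'def]
    exact Nat.ceil_pos.2 (by positivity)
  have h1' : (1 : ℝ) ≤ p.R' := by exact_mod_cast h1
  have hlow : 1 / Real.log 2 * Real.log X ≤ p.R' := by rw [hR'def]; exact Nat.le_ceil _
  have hup : (p.R' : ℝ) < 1 / Real.log 2 * Real.log X + 1 := by
    rw [hR'def]; exact Nat.ceil_lt_add_one (by positivity)
  have hlow' : Real.log X ≤ p.R' * Real.log 2 := by
    rw [one_div, inv_mul_le_iff₀ hl2] at hlow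
    linarith
  have hup' : (p.R' : ℝ) * Real.log 2 ≤ Real.log X + Real.log 2 := by
    have := mul_le_mul_of_nonneg_right hup.le hl2.le
    have h2 : (1 / Real.log 2 * Real.log X + 1) * Real.log 2 = Real.log X + Real.log 2 := by
      field_simp
    linarith
  have hXpos : 0 < X := by linarith
  have hRlow : 8 * ((p.R' : ℝ) / (1 - γ)) ≤ p.R := by rw [hRdef]; exact Nat.le_ceil _
  have hdiv : 1 ≤ (p.R' : ℝ) / (1 - γ) := by
    rw [le_div_iff₀ hu]; linarith
  have hRup : (p.R : ℝ) ≤ 9 * p.R' / (1 - γ) := by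
    have h2 : (p.R : ℝ) < 8 * ((p.R' : ℝ) / (1 - γ)) + 1 := by
      rw [hRdef]; exact Nat.ceil_lt_add_one (by positivity)
    rw [mul_div_assoc]
    linarith
  have hR8 : 8 ≤ (p.R : ℝ) := by linarith
  have hK' : (1 : ℝ) ≤ K := by exact_mod_cast hK
  have hbig : 8 ≤ p.R' * p.R * K / δ := by
    rw [le_div_iff₀ hδ0]
    have h2 : 8 ≤ (p.R' : ℝ) * p.R := by nlinarith
    have h3 : 8 ≤ (p.R' : ℝ) * p.R * K := by nlinarith
    linarith
  refine ⟨h1, ⟨?_, ?_⟩, hup', ⟨hRlow, hRup⟩, hR8, hbig, Real.log_pos (by linarith)⟩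
  · rw [← Real.log_le_log_iff hXpos (by positivity), Real.log_pow]
    exact hlow'
  · rw [← Real.log_le_log_iff (by positivity) (by positivity), Real.log_pow,
      Real.log_mul (by norm_num) hXpos.ne']
    linarith

theorem le_runParams_m :
    let p := runParams explicitConsts γ K L ε δ
    1024 * (L ^ 2 * p.logTerm K δ / (ε ^ 2 * (1 - γ) ^ 4)) ≤ p.m ∧
      256 * (L ^ 2 * p.logTerm K δ / (1 - γ) ^ 2) ≤ p.m₁ :=
  ⟨Nat.le_ceil _, Nat.le_ceil _⟩

theorem runParams_m_le (hγ1 : γ < 1) (hε0 : 0 < ε)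
    (hℓ : 0 < (runParams explicitConsts γ K L ε δ).logTerm K δ) :
    let p := runParams explicitConsts γ K L ε δ
    (p.m : ℝ) ≤ 1024 * (L ^ 2 * p.logTerm K δ / (ε ^ 2 * (1 - γ) ^ 4)) + 1 ∧
      (p.m₁ : ℝ) ≤ 256 * (L ^ 2 * p.logTerm K δ / (1 - γ) ^ 2) + 1 := by
  intro p
  have hu : 0 < 1 - γ := by linarith
  have hℓ' : 0 < p.logTerm K δ := hℓ
  have h1 : 0 ≤ 1024 * (L ^ 2 * p.logTerm K δ / (ε ^ 2 * (1 - γ) ^ 4)) := by positivity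
  have h2 : 0 ≤ 256 * (L ^ 2 * p.logTerm K δ / (1 - γ) ^ 2) := by positivity
  exact ⟨(Nat.ceil_lt_add_one h1).le, (Nat.ceil_lt_add_one h2).le⟩

theorem runParams_shift (i : ℕ) :
    let p := runParams explicitConsts γ K L ε δ
    p.shift i = L / (1 - γ) * √(p.logTerm K δ / p.m) +
      L * 2⁻¹ ^ i / (1 - γ) * √(p.logTerm K δ / p.m₁) := by
  intro p
  have h : p.shift i = 1 * (L / (1 - γ) * √(p.logTerm K δ / p.m)) +
    1 * (L * 2⁻¹ ^ i / (1 - γ) * √(p.logTerm K δ / p.m₁)) := rfl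
  rw [h, one_mul, one_mul]

theorem sqrt_div_le_of_le {ℓ a n : ℝ} (hℓ : 0 < ℓ) (ha : 0 < a) (h : ℓ / a ^ 2 ≤ n) :
    √(ℓ / n) ≤ a := by
  have hn : 0 < n := lt_of_lt_of_le (by positivity) h
  rw [Real.sqrt_le_left ha.le, div_le_iff₀ hn]
  rw [div_le_iff₀ (by positivity)] at h
  linarith

theorem runParams_shift_small (hγ0 : 0 ≤ γ) (hγ1 : γ < 1) (hε0 : 0 < ε) (hε1 : ε < 1)
    (hδ0 : 0 < δ) (hδ1 : δ < 1) (hK : 1 ≤ K) (hL : 0 < L) {i : ℕ}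
    (hi : i ≤ (runParams explicitConsts γ K L ε δ).R') :
    2 * (runParams explicitConsts γ K L ε δ).shift i / (1 - γ) ≤ 2⁻¹ ^ i / (1 - γ) / 4 := by
  obtain ⟨-, ⟨-, h2⟩, -, -, -, -, hℓ⟩ :=
    runParams_bounds (L := L) hγ0 hγ1 hε0 hε1 hδ0 hδ1 hK
  obtain ⟨hm, hm₁⟩ := le_runParams_m (γ := γ) (K := K) (L := L) (ε := ε) (δ := δ)
  rw [runParams_shift]
  generalize runParams explicitConsts γ K L ε δ = p at *
  have hu : 0 < 1 - γ := by linarith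
  generalize 1 - γ = u at *
  have hs : √(p.logTerm K δ / p.m) ≤ ε * u ^ 2 / (32 * L) :=
    sqrt_div_le_of_le hℓ (by positivity) (by
      refine le_trans (le_of_eq ?_) hm
      field_simp; norm_num)
  have hs₁ : √(p.logTerm K δ / p.m₁) ≤ u / (16 * L) :=
    sqrt_div_le_of_le hℓ (by positivity) (by
      refine le_trans (le_of_eq ?_) hm₁
      field_simp; norm_num)
  have h3 : ε * u ≤ 2 * 2⁻¹ ^ i := by
    have h4 : (2 : ℝ) ^ i ≤ 2 * (1 / (ε * u)) :=
      (pow_le_pow_right₀ (by norm_num) hi).trans h2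
    have h5 : 0 < ε * u := by positivity
    rw [mul_one_div, le_div_iff₀ h5] at h4
    rw [inv_pow, ← div_eq_mul_inv, le_div_iff₀ (by positivity)]
    linarith
  have h6 : L / u * √(p.logTerm K δ / p.m) ≤ ε * u / 32 := by
    refine (mul_le_mul_of_nonneg_left hs (by positivity)).trans (le_of_eq ?_)
    field_simp
  have h7 : L * 2⁻¹ ^ i / u * √(p.logTerm K δ / p.m₁) ≤ 2⁻¹ ^ i / 16 := by
    refine (mul_le_mul_of_nonneg_left hs₁ (by positivity)).trans (le_of_eq ?_)
    field_simp
  rw [div_right_comm]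
  refine div_le_div_of_nonneg_right ?_ hu.le
  linarith

theorem runParams_pow_le (hγ0 : 0 ≤ γ) (hγ1 : γ < 1) (hε0 : 0 < ε) (hε1 : ε < 1)
    (hδ0 : 0 < δ) (hδ1 : δ < 1) (hK : 1 ≤ K) :
    γ ^ (runParams explicitConsts γ K L ε δ).R ≤ 1 / 4 := by
  obtain ⟨h1, -, -, ⟨hR, -⟩, -, -, -⟩ :=
    runParams_bounds (L := L) hγ0 hγ1 hε0 hε1 hδ0 hδ1 hK
  generalize runParams explicitConsts γ K L ε δ = p at *
  have hu : 0 < 1 - γ := by linarith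
  have h1' : (1 : ℝ) ≤ p.R' := by exact_mod_cast h1
  have h2 : γ ≤ Real.exp (-(1 - γ)) := by linarith [Real.add_one_le_exp (-(1 - γ))]
  have h3 : 8 ≤ p.R * (1 - γ) := by
    have := mul_le_mul_of_nonneg_right hR hu.le
    rw [mul_assoc, div_mul_cancel₀ _ hu.ne'] at this
    linarith
  calc γ ^ p.R ≤ Real.exp (-(1 - γ)) ^ p.R := pow_le_pow_left₀ hγ0 h2 _
    _ = Real.exp (-(p.R * (1 - γ))) := by rw [← Real.exp_nat_mul]; ring_nf
    _ ≤ Real.exp (-8) := Real.exp_le_exp.2 (by linarith)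
    _ ≤ 1 / 4 := by
      rw [Real.exp_neg, ← one_div]
      exact one_div_le_one_div_of_le (by norm_num) (by linarith [Real.add_one_le_exp (8 : ℝ)])

theorem runParams_failure_le (hγ0 : 0 ≤ γ) (hγ1 : γ < 1) (hε0 : 0 < ε) (hε1 : ε < 1)
    (hδ0 : 0 < δ) (hδ1 : δ < 1) (hK : 1 ≤ K) :
    let p := runParams explicitConsts γ K L ε δ
    2 * (((p.R' : ℝ) + 1) * K * (p.R + 1)) * (2 * Real.exp (-(2 * p.logTerm K δ))) ≤ 2 * δ := by
  obtain ⟨h1, -, -, -, hR, hbig, -⟩ :=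
    runParams_bounds (L := L) hγ0 hγ1 hε0 hε1 hδ0 hδ1 hK
  intro p
  change 1 ≤ p.R' at h1
  change 8 ≤ (p.R : ℝ) at hR
  change 8 ≤ p.R' * p.R * K / δ at hbig
  have h1' : (1 : ℝ) ≤ p.R' := by exact_mod_cast h1
  have hexp : Real.exp (-(2 * p.logTerm K δ)) = ((p.R' * p.R * K / δ) ^ 2)⁻¹ := by
    rw [Real.exp_neg, RunParams.logTerm, two_mul, Real.exp_add, Real.exp_log (by linarith), sq]
  rw [hexp]
  set Z := (p.R' : ℝ) * p.R * K / δ with hZ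
  have hZδ : (p.R' : ℝ) * p.R * K = Z * δ := by rw [hZ]; field_simp
  have hcount : ((p.R' : ℝ) + 1) * K * (p.R + 1) ≤ 4 * (Z * δ) := by
    rw [← hZδ]
    calc ((p.R' : ℝ) + 1) * K * (p.R + 1) ≤ (p.R' + p.R') * K * (p.R + p.R) := by
          gcongr
          linarith
      _ = _ := by ring
  calc _ ≤ 2 * (4 * (Z * δ)) * (2 * (Z ^ 2)⁻¹) := by gcongr
    _ = 16 * δ / Z := by
      have : 0 < Z := by linarith
      field_simp
      norm_num
    _ ≤ 2 * δ := by
      rw [div_le_iff₀ (by linarith)]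
      nlinarith

theorem runParams_le_log (hγ0 : 0 ≤ γ) (hγ1 : γ < 1) (hε0 : 0 < ε) (hε1 : ε < 1)
    (hδ0 : 0 < δ) (hδ1 : δ < 1) (hK : 1 ≤ K) :
    let p := runParams explicitConsts γ K L ε δ
    let Λ := Real.log (2 * K / (ε * δ * (1 - γ)))
    1 / 2 ≤ Λ ∧ (p.R' : ℝ) ≤ 2 * Λ ∧ (p.R : ℝ) ≤ 18 * Λ / (1 - γ) ∧ p.logTerm K δ ≤ 6 * Λ := by
  obtain ⟨h1, ⟨-, h2⟩, h3, ⟨-, hR⟩, -, hbig, hℓ⟩ :=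
    runParams_bounds (L := L) hγ0 hγ1 hε0 hε1 hδ0 hδ1 hK
  generalize runParams explicitConsts γ K L ε δ = p at *
  change 1 / 2 ≤ Real.log (2 * K / (ε * δ * (1 - γ))) ∧
    (p.R' : ℝ) ≤ 2 * Real.log (2 * K / (ε * δ * (1 - γ))) ∧
    (p.R : ℝ) ≤ 18 * Real.log (2 * K / (ε * δ * (1 - γ))) / (1 - γ) ∧
    p.logTerm K δ ≤ 6 * Real.log (2 * K / (ε * δ * (1 - γ)))
  have hu : 0 < 1 - γ := by linarith
  have hu1 : 1 - γ ≤ 1 := by linarith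
  generalize 1 - γ = u at *
  have hK' : (1 : ℝ) ≤ K := by exact_mod_cast hK
  have h1' : (1 : ℝ) ≤ p.R' := by exact_mod_cast h1
  set X := 1 / (ε * u) with hX
  have hX1 : 1 ≤ X := by
    rw [hX, le_div_iff₀ (by positivity)]
    nlinarith
  have hXu : 1 / u ≤ X := by
    rw [hX]
    exact one_div_le_one_div_of_le (by positivity) (by nlinarith)
  have hD : 1 ≤ 1 / δ := by rw [le_div_iff₀ hδ0]; linarith
  have hB : 2 * K / (ε * δ * u) = 2 * K * (1 / δ) * X := by rw [hX]; field_simp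
  rw [hB]
  set D := 1 / δ
  have hKD : 1 ≤ K * D := by nlinarith
  have hKDX : X ≤ K * D * X := by nlinarith
  have hl2 : 1 / 2 ≤ Real.log 2 := by linarith [Real.log_two_gt_d9]
  set Λ := Real.log (2 * K * D * X) with hΛ
  have hΛX : Real.log X + Real.log 2 ≤ Λ := by
    rw [← Real.log_mul (by positivity) (by norm_num)]
    exact Real.log_le_log (by positivity) (by linarith)
  have hΛ2 : 1 / 2 ≤ Λ := by linarith [Real.log_nonneg hX1]
  have hR'Λ : (p.R' : ℝ) ≤ 2 * Λ := by nlinarith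
  have hRΛ : (p.R : ℝ) ≤ 18 * Λ / u := by
    refine hR.trans (div_le_div_of_nonneg_right ?_ hu.le)
    linarith
  have hℓΛ : p.logTerm K δ ≤ 6 * Λ := by
    have h4 : (p.R' : ℝ) ≤ 2 * X := by
      refine le_trans ?_ h2
      exact_mod_cast (Nat.lt_two_pow_self (n := p.R')).le
    have h5 : (p.R : ℝ) ≤ 18 * X * X := by
      refine hR.trans ?_
      rw [mul_div_assoc, div_eq_mul_one_div]
      have := mul_le_mul h4 hXu (by positivity) (by positivity)
      linarith
    have h6 : p.R' * p.R * K / δ ≤ (2 * K * D * X) ^ 6 := by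
      have e1 : (p.R' : ℝ) * p.R * K / δ = p.R' * p.R * (K * D) := by
        rw [div_eq_mul_one_div]; ring
      have e2 : (2 * K * D * X) ^ 6 = 64 * (K * D) ^ 6 * X ^ 6 := by ring
      rw [e1, e2]
      have h7 : (K * D) ≤ (K * D) ^ 6 := le_self_pow₀ hKD (by norm_num)
      have h8 : X ^ 3 ≤ X ^ 6 := pow_le_pow_right₀ hX1 (by norm_num)
      calc (p.R' : ℝ) * p.R * (K * D) ≤ (2 * X) * (18 * X * X) * (K * D) := by gcongr
        _ = 36 * (K * D) * X ^ 3 := by ring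
        _ ≤ 64 * (K * D) ^ 6 * X ^ 6 := by gcongr; norm_num
    calc p.logTerm K δ ≤ Real.log ((2 * K * D * X) ^ 6) :=
          Real.log_le_log (by linarith) h6
      _ = 6 * Λ := by rw [Real.log_pow, ← hΛ]; norm_num
  exact ⟨hΛ2, hR'Λ, hRΛ, hℓΛ⟩

theorem runParams_count_le (hγ0 : 0 ≤ γ) (hγ1 : γ < 1) (hε0 : 0 < ε) (hε1 : ε < 1)
    (hδ0 : 0 < δ) (hδ1 : δ < 1) (hK : 1 ≤ K) (hL : 1 ≤ L) :
    let p := runParams explicitConsts γ K L ε δ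
    2 * (((p.R' : ℝ) + 1) * (K * (p.m + p.R * p.m₁))) ≤
      320000 * (K * L ^ 2 / ((1 - γ) ^ 4 * ε ^ 2)) *
        Real.log (2 * K / (ε * δ * (1 - γ))) ^ 3 := by
  obtain ⟨-, -, -, -, -, -, hℓ⟩ := runParams_bounds (L := L) hγ0 hγ1 hε0 hε1 hδ0 hδ1 hK
  obtain ⟨hΛ2, hR'Λ, hRΛ, hℓΛ⟩ := runParams_le_log (L := L) hγ0 hγ1 hε0 hε1 hδ0 hδ1 hK
  obtain ⟨hm, hm₁⟩ := runParams_m_le hγ1 hε0 hℓ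
  generalize runParams explicitConsts γ K L ε δ = p at *
  change 2 * (((p.R' : ℝ) + 1) * (K * (p.m + p.R * p.m₁))) ≤
    320000 * (K * L ^ 2 / ((1 - γ) ^ 4 * ε ^ 2)) * Real.log (2 * K / (ε * δ * (1 - γ))) ^ 3
  generalize Real.log (2 * K / (ε * δ * (1 - γ))) = Λ at *
  have hu : 0 < 1 - γ := by linarith
  have hu1 : 1 - γ ≤ 1 := by linarith
  generalize 1 - γ = u at *
  have hL2 : 1 ≤ L ^ 2 := one_le_pow₀ hL
  set Y := L ^ 2 / (ε ^ 2 * u ^ 4) with hY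
  have hW1 : 1 ≤ L ^ 2 / u ^ 2 := by
    rw [le_div_iff₀ (by positivity)]
    have : u ^ 2 ≤ 1 := pow_le_one₀ hu.le hu1
    linarith
  have hY1 : 1 ≤ Y := by
    rw [hY, le_div_iff₀ (by positivity)]
    have h4 : u ^ 4 ≤ 1 := pow_le_one₀ hu.le hu1
    have h5 : ε ^ 2 ≤ 1 := pow_le_one₀ hε0.le hε1.le
    have h6 : ε ^ 2 * u ^ 4 ≤ 1 := mul_le_one₀ h5 (by positivity) h4
    linarith
  have hWY : L ^ 2 / u ^ 3 ≤ Y := by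
    refine div_le_div_of_nonneg_left (by positivity) (by positivity) ?_
    have h5 : ε ^ 2 ≤ 1 := pow_le_one₀ hε0.le hε1.le
    calc ε ^ 2 * u ^ 4 ≤ 1 * u ^ 3 :=
          mul_le_mul h5 (pow_le_pow_of_le_one hu.le hu1 (by norm_num)) (by positivity) (by norm_num)
      _ = u ^ 3 := one_mul _
  have hmΛ : (p.m : ℝ) ≤ 6146 * Λ * Y := by
    have h4 : 1024 * (L ^ 2 * p.logTerm K δ / (ε ^ 2 * u ^ 4)) = 1024 * p.logTerm K δ * Y := by
      rw [hY]; ring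
    rw [h4] at hm
    have h5 := mul_le_mul_of_nonneg_right hℓΛ (zero_le_one.trans hY1)
    have h6 := mul_le_mul hΛ2 hY1 zero_le_one (by linarith)
    linarith
  have hm₁Λ : (p.m₁ : ℝ) ≤ 1538 * Λ * (L ^ 2 / u ^ 2) := by
    have h4 : 256 * (L ^ 2 * p.logTerm K δ / u ^ 2) = 256 * p.logTerm K δ * (L ^ 2 / u ^ 2) := by
      ring
    rw [h4] at hm₁
    have h5 := mul_le_mul_of_nonneg_right hℓΛ (zero_le_one.trans hW1)
    have h6 := mul_le_mul hΛ2 hW1 zero_le_one (by linarith)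
    linarith
  have hRm : (p.R : ℝ) * p.m₁ ≤ 27684 * Λ ^ 2 * Y := by
    calc (p.R : ℝ) * p.m₁ ≤ 18 * Λ / u * (1538 * Λ * (L ^ 2 / u ^ 2)) := by gcongr
      _ = 27684 * Λ ^ 2 * (L ^ 2 / u ^ 3) := by field_simp; norm_num
      _ ≤ _ := by gcongr
  have hsum : (p.m : ℝ) + p.R * p.m₁ ≤ 40000 * Λ ^ 2 * Y := by
    have h4 : Λ ≤ 2 * Λ ^ 2 := by
      have := mul_le_mul_of_nonneg_left hΛ2 (by linarith : 0 ≤ Λ)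
      linarith
    have h5 : Λ * Y ≤ 2 * Λ ^ 2 * Y := mul_le_mul_of_nonneg_right h4 (by linarith)
    have h6 : 0 ≤ Λ ^ 2 * Y := by positivity
    linarith
  calc _ ≤ 2 * ((4 * Λ) * (K * (40000 * Λ ^ 2 * Y))) := by gcongr; linarith
    _ = _ := by rw [hY, mul_comm (u ^ 4)]; ring

end Params

section Final

variable {S : Type*} {A : S → Type*} {K : ℕ} {M : TBSG S A} {φ : Features A K}
  {𝒦 : Fin K → (s : S) × A s} {L : ℝ}

theorem AnchorBound.one_le (h : AnchorBound φ 𝒦 L) (hK : 1 ≤ K) : 1 ≤ L := by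
  obtain ⟨hφ, -, hu, hL⟩ := h
  have hdet := (Matrix.isUnit_iff_isUnit_det _).1 hu
  let k : Fin K := ⟨0, hK⟩
  have h1 := congrFun (congrFun (Matrix.nonsing_inv_mul (anchorMatrix φ 𝒦) hdet) k) k
  rw [Matrix.mul_apply, Matrix.one_apply_eq] at h1
  rw [← h1]
  refine le_trans (Finset.sum_le_sum fun l _ => ?_) (hL k)
  refine (le_abs_self _).trans ?_
  rw [abs_mul]
  refine mul_le_of_le_one_right (abs_nonneg _) (le_trans ?_ (hφ (𝒦 l).1 (𝒦 l).2))
  exact Finset.single_le_sum (f := fun i => |φ (𝒦 l).1 (𝒦 l).2 i|) (fun _ _ => abs_nonneg _)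
    (Finset.mem_univ k)

theorem Embeds.isEmpty [∀ s, Nonempty (A s)] (h : M.Embeds φ) (hK : K = 0) : IsEmpty S := by
  subst hK
  obtain ⟨ψ, hψ⟩ := h
  refine ⟨fun s => ?_⟩
  have a : A s := Classical.arbitrary _
  have h0 : ∀ x, M.P s a x = 0 := fun x => by
    have := hψ s a x
    rw [Finset.univ_eq_empty, Finset.sum_empty, ENNReal.toReal_eq_zero_iff] at this
    exact this.resolve_right ((M.P s a).apply_ne_top x)
  have h1 := (M.P s a).tsum_coe
  simp [h0] at h1

instance [MeasurableSpace S] (p : RunParams) : IsProbabilityMeasure (M.sampleLaw 𝒦 p) := by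
  unfold sampleLaw; infer_instance

theorem sampleCount_eq (K : ℕ) (p : RunParams) :
    (sampleCount K p : ℝ) = 2 * (((p.R' : ℝ) + 1) * (K * (p.m + p.R * p.m₁))) := by
  simp [sampleCount, Draw, RunDraw, LocalDraw]

variable [Countable S] [MeasurableSpace S] [MeasurableSingletonClass S]

/-- On an empty state space every strategy pair is optimal. -/
theorem isEpsOptimal_of_isEmpty [IsEmpty S] (ε : ℝ) (π : Strategy A) : M.IsEpsOptimal ε π :=
  ⟨isEmptyElim, ⟨π, fun _ s => isEmptyElim s, funext isEmptyElim⟩, isEmptyElim⟩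

variable [∀ s, Finite (A s)] [∀ s, Nonempty (A s)] {ε δ : ℝ}

/-- The one-sided algorithm with the explicit parameters is `ε`-accurate on accurate samples. -/
theorem oneSided_explicit (hM : M.Embeds φ) (h0 : ∀ s a k, 0 ≤ φ s a k) (hA : AnchorBound φ 𝒦 L)
    (hK : 1 ≤ K) (hε0 : 0 < ε) (hε1 : ε < 1) (hδ0 : 0 < δ) (hδ1 : δ < 1) {v : S → ℝ} (hv : Bdd v)
    (hf : ∀ s, M.bellman v s = v s)
    {x : RunDraw K (runParams explicitConsts M.γ K L ε δ) → S}
    (hacc : ∀ i k o, M.Accurate φ 𝒦 (runParams explicitConsts M.γ K L ε δ)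
      ((runParams explicitConsts M.γ K L ε δ).logTerm K δ) x i k o) :
    M.Pessimistic φ (M.oneSided φ 𝒦 (runParams explicitConsts M.γ K L ε δ) x) ∧
      ∀ s, v s - M.V φ (M.oneSided φ 𝒦 (runParams explicitConsts M.γ K L ε δ) x) s ≤ ε := by
  have hL := hA.2.1
  obtain ⟨-, ⟨hX, -⟩, -⟩ :=
    runParams_bounds (L := L) M.γ_nonneg M.γ_lt_one hε0 hε1 hδ0 hδ1 hK
  have h := oneSided_spec hM h0 hA hv hf (x := x) (fun i => ?_) (fun i hi => ?_)
    (runParams_pow_le M.γ_nonneg M.γ_lt_one hε0 hε1 hδ0 hδ1 hK) hacc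
  · refine ⟨h.1, fun s => (h.2 s).trans ?_⟩
    have hu := M.one_sub_γ_pos
    generalize (runParams explicitConsts M.γ K L ε δ).R' = R' at hX ⊢
    rw [gap, inv_pow, div_le_iff₀ hu, inv_le_comm₀ (by positivity) (by positivity), ← one_div]
    refine hX.trans ?_
    exact pow_le_pow_right₀ (by norm_num) (Nat.le_succ _)
  · rw [runParams_shift]
    refine le_of_eq ?_
    simp only [gap, pow_zero]
    ring
  · exact runParams_shift_small M.γ_nonneg M.γ_lt_one hε0 hε1 hδ0 hδ1 hK hL hi

/-- On accurate samples every output of the two-sided algorithm is `ε`-optimal. -/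
theorem isEpsOptimal_of_accurate (hM : M.Embeds φ) (h0 : ∀ s a k, 0 ≤ φ s a k)
    (hA : AnchorBound φ 𝒦 L) (hK : 1 ≤ K) (hε0 : 0 < ε) (hε1 : ε < 1) (hδ0 : 0 < δ) (hδ1 : δ < 1)
    {x : Draw K (runParams explicitConsts M.γ K L ε δ) → S}
    (hacc : ∀ c i k o, (![M, M.flip] c).Accurate φ 𝒦 (runParams explicitConsts M.γ K L ε δ)
      ((runParams explicitConsts M.γ K L ε δ).logTerm K δ) (fun q => x (c, q)) i k o) :
    (∃ π, M.IsTwoSidedOutput φ 𝒦 (runParams explicitConsts M.γ K L ε δ) x π) ∧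
      ∀ π, M.IsTwoSidedOutput φ 𝒦 (runParams explicitConsts M.γ K L ε δ) x π →
        M.IsEpsOptimal ε π := by
  obtain ⟨v, hv, hf⟩ := M.exists_bellman_fixedPoint
  have h1 := oneSided_explicit hM h0 hA hK hε0 hε1 hδ0 hδ1 hv hf (hacc 0)
  have h2 := oneSided_explicit (M := M.flip) hM.flip h0 hA hK hε0 hε1 hδ0 hδ1
    ((bdd_const (1 / (1 - M.γ))).sub hv) (fun s => by rw [flip_bellman M hv, hf]) (hacc 1)
  refine ⟨?_, fun π hπ => isEpsOptimal_of_pessimistic hA.1 hv hf h1.1 h2.1 h1.2 h2.2 hπ⟩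
  choose π₁ hπ₁ using fun s => M.exists_isGreedy φ ⟨0, h1.1.1⟩ s
  choose π₂ hπ₂ using fun s => M.flip.exists_isGreedy φ ⟨0, h2.1.1⟩ s
  refine ⟨M.pair π₁ π₂, fun s => ?_⟩
  cases hs : M.isMax s
  · simp only [pair, hs, Bool.false_eq_true, if_false]
    exact hπ₂ s
  · simp only [pair, hs, if_true]
    exact hπ₁ s

theorem ofReal_one_sub_le_measure {Ω : Type*} [MeasurableSpace Ω] {μ : Measure Ω}
    [IsProbabilityMeasure μ] {s t : Set Ω} (hst : s ⊆ t) {q : ℝ} (hq : 0 ≤ q)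
    (h : μ sᶜ ≤ ENNReal.ofReal q) : ENNReal.ofReal (1 - q) ≤ μ t := by
  rw [ENNReal.ofReal_sub _ hq, ENNReal.ofReal_one, tsub_le_iff_right]
  calc (1 : ENNReal) = μ (s ∪ sᶜ) := by simp
    _ ≤ μ s + μ sᶜ := measure_union_le _ _
    _ ≤ μ t + ENNReal.ofReal q := add_le_add (measure_mono hst) h

end Final

end TBSG

end

theorem theorem2 :
    ∃ (c : TBSG.HiddenConsts) (C : ℝ) (d : ℕ), c.Pos ∧ 0 < C ∧
      ∀ (S : Type*) (A : S → Type*) [Countable S] [MeasurableSpace S] [MeasurableSingletonClass S]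
        [∀ s, Finite (A s)] [∀ s, Nonempty (A s)]
        (M : TBSG S A) (K : ℕ) (φ : TBSG.Features A K) (𝒦 : Fin K → (s : S) × A s)
        (L ε δ : ℝ),
        M.Embeds φ → (∀ s a k, 0 ≤ φ s a k) → TBSG.AnchorBound φ 𝒦 L →
        0 < ε → ε < 1 → 0 < δ → δ < 1 →
        ENNReal.ofReal (1 - 2 * δ) ≤
            M.sampleLaw 𝒦 (TBSG.runParams c M.γ K L ε δ)
              {x | (∃ π, M.IsTwoSidedOutput φ 𝒦 (TBSG.runParams c M.γ K L ε δ) x π) ∧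
                ∀ π, M.IsTwoSidedOutput φ 𝒦 (TBSG.runParams c M.γ K L ε δ) x π →
                  M.IsEpsOptimal ε π} ∧
          (TBSG.sampleCount K (TBSG.runParams c M.γ K L ε δ) : ℝ) ≤
            C * (K * L ^ 2 / ((1 - M.γ) ^ 4 * ε ^ 2)) *
              Real.log (2 * K / (ε * δ * (1 - M.γ))) ^ d := by
  refine ⟨TBSG.explicitConsts, 320000, 3, ?_, by norm_num, ?_⟩
  · have := Real.log_pos (one_lt_two (α := ℝ))
    simp only [TBSG.HiddenConsts.Pos, TBSG.explicitConsts]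
    refine ⟨by positivity, ?_, ?_, ?_, ?_, ?_⟩ <;> norm_num
  intro S A _ _ _ _ _ M K φ 𝒦 L ε δ hM h0 hA hε0 hε1 hδ0 hδ1
  rcases Nat.eq_zero_or_pos K with hK | hK
  · have := hM.isEmpty hK
    constructor
    · refine TBSG.ofReal_one_sub_le_measure (s := Set.univ) ?_ (by linarith) (by simp)
      intro x _
      exact ⟨⟨isEmptyElim, fun s => isEmptyElim s⟩, fun π _ => TBSG.isEpsOptimal_of_isEmpty ε π⟩
    · rw [TBSG.sampleCount_eq, hK]
      simp
  · refine ⟨?_, ?_⟩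
    · have hb := TBSG.runParams_bounds (L := L) M.γ_nonneg M.γ_lt_one hε0 hε1 hδ0 hδ1 hK
      have hℓ := hb.2.2.2.2.2.2
      have hL := hA.2.1
      have hu := M.one_sub_γ_pos
      have hm := TBSG.le_runParams_m (γ := M.γ) (K := K) (L := L) (ε := ε) (δ := δ)
      have hfail := TBSG.runParams_failure_le (L := L) M.γ_nonneg M.γ_lt_one hε0 hε1 hδ0 hδ1 hK
      refine TBSG.ofReal_one_sub_le_measure
        (fun x hx => TBSG.isEpsOptimal_of_accurate hM h0 hA hK hε0 hε1 hδ0 hδ1 hx) (by linarith)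
        ((TBSG.measure_exists_not_accurate_le ![M, M.flip] (fun c => ?_) hℓ.le ?_ ?_).trans
          (ENNReal.ofReal_le_ofReal hfail))
      · fin_cases c <;> rfl
      · exact Nat.cast_pos.1 (lt_of_lt_of_le (by positivity) hm.1)
      · exact Nat.cast_pos.1 (lt_of_lt_of_le (by positivity) hm.2)
    · rw [TBSG.sampleCount_eq]
      exact TBSG.runParams_count_le M.γ_nonneg M.γ_lt_one hε0 hε1 hδ0 hδ1 hK (hA.one_le hK)
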